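/- Let $d,q,\sigma\ge 1$ be integers, $V\ge 0$, $\nu,\mu,r_1,r_2\in\mathbb R$, let $Q:\mathbb T^d\to\mathbb R^q$ be smooth on the torus $\mathbb T^d=\mathbb R^d/2\pi\mathbb Z^d$, and let $s>d/2$. Write $J_T=[0,T]$ and let $H^s=H^s(\mathbb T^d;\mathbb C)$ be the Sobolev space with norm $\|f\|_s^2=\sum_{k\in\mathbb Z^d}(1+|k|^2)^s|\widehat f(k)|^2$, where $\widehat f(k)=(2\pi)^{-d}\int_{[0,2\pi]^d}f(x)e^{-i\langle k,x\rangle}\,dx$. Consider the controlled complex Ginzburg--Landau problem $$\partial_t\psi=V\psi+(1+i\nu)\Delta\psi-(1+i\mu)|\psi|^{2\sigma}\psi+(r_1+ir_2)\langle u(t),Q(x)\rangle\psi,\qquad \psi(0)=\psi_0. \tag{1}$$ A solution of (1) on $J_T$ is a mild solution: a function $\psi\in C(J_T;H^s)$ with $$\psi(t)=S(t)\psi_0+\int_0^tS(t-\tau)\big[-(1+i\mu)|\psi(\tau)|^{2\sigma}\psi(\tau)+(r_1+ir_2)\langle u(\tau),Q\rangle\psi(\tau)\big]\,d\tau,\qquad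 t\in J_T,$$ where $S(t)$ is the semigroup on $H^s$ with $\widehat{S(t)f}(k)=e^{(V-(1+i\nu)|k|^2)t}\widehat f(k)$ and the integral is taken in $H^s$. There are functions $\delta(T,\Lambda)>0$ and $C(T,\Lambda)>0$ (depending otherwise only on $d,q,\sigma,V,\nu,\mu,r_1,r_2,Q,s$) such that for all $\tilde\psi_0\in H^s$ and $\tilde u\in L^2_{\rm loc}(\mathbb R_+;\mathbb R^q)$ the following holds. 1. There are a maximal time $\tilde T=\tilde T(\tilde\psi_0,\tilde u)\in(0,\infty]$ and a function $\tilde\psi:[0,\tilde T)\to H^s$ such that, for every $0\le T<\tilde T$, the restriction of $\tilde\psi$ to $J_T$ is the unique solution in $C(J_T;H^s)$ of (1) with $(\psi_0,u)=(\tilde\psi_0,\tilde u)$; for real $T\ge\tilde T$ there is no solution on $J_T$. 2. If $\tilde T<\infty$, then $\|\tilde\psi(t)\|_s\to\infty$ as $t\to\tilde T^-$. 3. Let $0\le T<\tilde T$ and $\Lambda=\|\tilde\psi\|_{C(J_T;H^s)}+\|\tilde u\|_{L^2(J_T;\mathbb R^q)}$. For all $\psi_0\in H^s$ and $u\in L^2(J_T;\mathbb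 R^q)$ with $$\|\psi_0-\tilde\psi_0\|_s+\|u-\tilde u\|_{L^2(J_T;\mathbb R^q)}<\delta(T,\Lambda), \tag{2}$$ problem (1) has a unique solution $\mathcal R(\psi_0,u)\in C(J_T;H^s)$, and $$\|\mathcal R(\psi_0,u)-\tilde\psi\|_{C(J_T;H^s)}\le C(T,\Lambda)\big(\|\psi_0-\tilde\psi_0\|_s+\|u-\tilde u\|_{L^2(J_T;\mathbb R^q)}\big).$$ More generally, for any two pairs $(\psi_{0,1},u_1)$, $(\psi_{0,2},u_2)$ satisfying (2), $$\|\mathcal R(\psi_{0,1},u_1)-\mathcal R(\psi_{0,2},u_2)\|_{C(J_T;H^s)}\le C(T,\Lambda)\big(\|\psi_{0,1}-\psi_{0,2}\|_s+\|u_1-u_2\|_{L^2(J_T;\mathbb R^q)}\big).$$ -/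

import Mathlib

open MeasureTheory Filter Topology Set
open scoped Real NNReal ENNReal ContDiff ComplexConjugate

noncomputable section

namespace CGL

instance instTwoPiPos : Fact (0 < 2 * π) := ⟨Real.two_pi_pos⟩

/-- The torus `ℝᵈ / 2πℤᵈ`. -/
abbrev Torus (d : ℕ) : Type := Fin d → AddCircle (2 * π)

/-- The normalised Haar measure `(2π)⁻ᵈ dx` on the torus. -/
def torusMeasure (d : ℕ) : Measure (Torus d) :=
  Measure.pi fun _ => AddCircle.haarAddCircle

instance (d : ℕ) : IsProbabilityMeasure (torusMeasure d) := by
  unfold torusMeasure; infer_instance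

/-- The character `x ↦ exp (i ⟨k, x⟩)` of the torus. -/
def char {d : ℕ} (k : Fin d → ℤ) : C(Torus d, ℂ) where
  toFun x := ∏ i, fourier (k i) (x i)
  continuous_toFun := by fun_prop

theorem char_coe {d : ℕ} (k : Fin d → ℤ) (x : Fin d → ℝ) :
    char k (fun i => (x i : AddCircle (2 * π))) =
      Complex.exp (Complex.I * ∑ i, (k i : ℂ) * (x i : ℂ)) := by
  simp only [char, ContinuousMap.coe_mk, fourier_coe_apply]
  rw [← Complex.exp_sum, Finset.mul_sum]
  congr 1
  refine Finset.sum_congr rfl fun i _ => ?_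
  have : (π : ℂ) ≠ 0 := by exact_mod_cast Real.pi_ne_zero
  push_cast
  field_simp

/-- The Fourier coefficient `∫ f(x) exp (-i ⟨k, x⟩) (2π)⁻ᵈ dx`. -/
def fourierCoef {d : ℕ} (f : Torus d → ℂ) (k : Fin d → ℤ) : ℂ :=
  ∫ x, f x * char (-k) x ∂torusMeasure d

/-- `|k|² = k₁² + ⋯ + k_d²`. -/
def sqNorm {d : ℕ} (k : Fin d → ℤ) : ℝ := ∑ i, (k i : ℝ) ^ 2

theorem sqNorm_nonneg {d : ℕ} (k : Fin d → ℤ) : 0 ≤ sqNorm k :=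
  Finset.sum_nonneg fun _ _ => sq_nonneg _

/-- The Lebesgue space `L²` of the torus. -/
abbrev L2 (d : ℕ) : Type := Lp ℂ 2 (torusMeasure d)

/-! The characters form a Hilbert basis of `L²`. -/

theorem char_neg {d : ℕ} (k : Fin d → ℤ) (x : Torus d) : char (-k) x = conj (char k x) := by
  simp [char]

theorem char_add {d : ℕ} (k l : Fin d → ℤ) (x : Torus d) :
    char (k + l) x = char k x * char l x := by
  simp [char, Finset.prod_mul_distrib]

theorem char_zero {d : ℕ} : char (0 : Fin d → ℤ) = 1 := by
  ext x; simp [char]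

theorem char_single {d : ℕ} (i : Fin d) (x : Torus d) :
    char (Pi.single i 1) x = AddCircle.toCircle (x i) := by
  simp only [char, ContinuousMap.coe_mk]
  rw [Finset.prod_eq_single i]
  · simp
  · intro j _ hj; simp [hj]
  · simp

def charSubalgebra (d : ℕ) : StarSubalgebra ℂ C(Torus d, ℂ) where
  toSubalgebra := Algebra.adjoin ℂ (range char)
  star_mem' := by
    change Algebra.adjoin ℂ (range char) ≤ star (Algebra.adjoin ℂ (range char))
    refine Algebra.adjoin_le ?_
    rintro _ ⟨n, rfl⟩
    refine Algebra.subset_adjoin ⟨-n, ?_⟩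
    ext1 x
    simp [char_neg]

theorem charSubalgebra_coe (d : ℕ) :
    (charSubalgebra d).toSubalgebra.toSubmodule = Submodule.span ℂ (range char) := by
  apply Algebra.adjoin_eq_span_of_subset
  refine .trans (fun x => Submonoid.closure_induction (fun _ => id) ⟨0, char_zero⟩ ?_)
    Submodule.subset_span
  rintro _ _ _ _ ⟨m, rfl⟩ ⟨n, rfl⟩
  exact ⟨m + n, by ext x; simp [char_add]⟩

theorem charSubalgebra_separatesPoints (d : ℕ) : (charSubalgebra d).SeparatesPoints := by
  intro x y hxy
  rw [Ne, funext_iff, not_forall] at hxy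
  obtain ⟨i, hi⟩ := hxy
  refine ⟨_, ⟨char (Pi.single i 1), Algebra.subset_adjoin ⟨Pi.single i 1, rfl⟩, rfl⟩, ?_⟩
  simp only [char_single, Ne]
  contrapose hi
  exact AddCircle.injective_toCircle Real.two_pi_pos.ne' (Subtype.coe_injective hi)

theorem span_char_closure_eq_top (d : ℕ) :
    (Submodule.span ℂ (range (char (d := d)))).topologicalClosure = ⊤ := by
  rw [← charSubalgebra_coe]
  exact congr_arg (Subalgebra.toSubmodule <| StarSubalgebra.toSubalgebra ·)
    (ContinuousMap.starSubalgebra_topologicalClosure_eq_top_of_separatesPoints _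
      (charSubalgebra_separatesPoints d))

/-- The characters as elements of `L²`. -/
abbrev charL2 {d : ℕ} (k : Fin d → ℤ) : L2 d :=
  ContinuousMap.toLp (E := ℂ) 2 (torusMeasure d) ℂ (char k)

theorem orthonormal_charL2 (d : ℕ) : Orthonormal ℂ (charL2 (d := d)) := by
  rw [orthonormal_iff_ite]
  intro m n
  simp only [ContinuousMap.inner_toLp, ← char_neg, ← char_add]
  split_ifs with h
  · simp [h, char_zero]
  · simp only [char, ContinuousMap.coe_mk, torusMeasure]
    rw [MeasureTheory.integral_fintype_prod_eq_prod]
    obtain ⟨i, hi⟩ := Function.ne_iff.mp h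
    apply Finset.prod_eq_zero (Finset.mem_univ i)
    have := (orthonormal_iff_ite.mp (orthonormal_fourier (T := 2 * π))) (m i) (n i)
    simpa only [eq_false_intro hi, if_false, ContinuousMap.inner_toLp, ← fourier_neg,
      ← fourier_add] using! this

theorem span_charL2_closure_eq_top (d : ℕ) :
    (Submodule.span ℂ (range (charL2 (d := d)))).topologicalClosure = ⊤ := by
  have h := (ContinuousMap.toLp_denseRange ℂ (torusMeasure d) ℂ
    (p := 2) (by simp)).topologicalClosure_map_submodule (span_char_closure_eq_top d)
  simpa only [Submodule.map_span, ContinuousLinearMap.coe_coe, ← range_comp,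
    Function.comp_def] using h

def charBasis (d : ℕ) : HilbertBasis (Fin d → ℤ) ℂ (L2 d) :=
  HilbertBasis.mk (orthonormal_charL2 d) (span_charL2_closure_eq_top d).ge

theorem charBasis_repr {d : ℕ} (f : L2 d) (k : Fin d → ℤ) :
    (charBasis d).repr f k = fourierCoef f k := by
  trans ∫ x, conj (charL2 k x) * f x ∂torusMeasure d
  · rw [(charBasis d).repr_apply_apply f k, MeasureTheory.L2.inner_def]
    simp only [charBasis, HilbertBasis.coe_mk, RCLike.inner_apply, mul_comm]
  · apply integral_congr_ae
    filter_upwards [ContinuousMap.coeFn_toLp (𝕜 := ℂ) (p := 2) (torusMeasure d) (char k)]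
      with x hx
    rw [hx, ← char_neg, mul_comm]

theorem fourierCoef_add {d : ℕ} (f g : L2 d) (k : Fin d → ℤ) :
    fourierCoef (f + g : L2 d) k = fourierCoef f k + fourierCoef g k := by
  rw [← charBasis_repr, ← charBasis_repr, ← charBasis_repr, map_add]
  rfl

theorem fourierCoef_smul {d : ℕ} (c : ℂ) (f : L2 d) (k : Fin d → ℤ) :
    fourierCoef (c • f : L2 d) k = c * fourierCoef f k := by
  rw [← charBasis_repr, ← charBasis_repr, map_smul]
  rfl

theorem fourierCoef_zero {d : ℕ} (k : Fin d → ℤ) : fourierCoef (0 : L2 d) k = 0 := by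
  rw [← charBasis_repr, map_zero]
  rfl

/-! Sobolev spaces. -/

/-- The weight `(1 + |k|²)ˢ`. -/
def weight {d : ℕ} (s : ℝ) (k : Fin d → ℤ) : ℝ := (1 + sqNorm k) ^ s

theorem weight_pos {d : ℕ} (s : ℝ) (k : Fin d → ℤ) : 0 < weight s k :=
  Real.rpow_pos_of_pos (by linarith [sqNorm_nonneg k]) s

theorem norm_sqrt_weight_mul_sq {d : ℕ} (s : ℝ) (k : Fin d → ℤ) (z : ℂ) :
    ‖((√(weight s k) : ℝ) : ℂ) * z‖ ^ 2 = weight s k * ‖z‖ ^ 2 := by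
  rw [norm_mul, mul_pow, Complex.norm_real, Real.norm_eq_abs, sq_abs,
    Real.sq_sqrt (weight_pos s k).le]

theorem memlp_iff {d : ℕ} (s : ℝ) (a : (Fin d → ℤ) → ℂ) :
    Memℓp (fun k => ((√(weight s k) : ℝ) : ℂ) * a k) 2 ↔
      Summable fun k => weight s k * ‖a k‖ ^ 2 := by
  rw [memℓp_gen_iff (by simp)]
  simp only [ENNReal.toReal_ofNat, Real.rpow_two, norm_sqrt_weight_mul_sq]

/-- The functions `f ∈ L²` with `∑ (1 + |k|²)ˢ |f̂(k)|² < ∞`. -/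
def sobolevSubmodule (d : ℕ) (s : ℝ) : Submodule ℂ (L2 d) where
  carrier := {f | Summable fun k => weight s k * ‖fourierCoef f k‖ ^ 2}
  zero_mem' := by
    change Summable fun k => weight s k * ‖fourierCoef (0 : L2 d) k‖ ^ 2
    simp only [fourierCoef_zero]
    simp [summable_zero]
  add_mem' := by
    intro f g hf hg
    refine (memlp_iff s _).1 ?_
    convert! ((memlp_iff s _).2 hf).add ((memlp_iff s _).2 hg) using 1
    ext k
    rw [fourierCoef_add, mul_add]
    rfl
  smul_mem' := by
    intro c f hf
    refine (memlp_iff s _).1 ?_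
    convert! ((memlp_iff s _).2 hf).const_smul c using 1
    ext k
    rw [fourierCoef_smul, mul_left_comm]
    rfl

/-- The Sobolev space `Hˢ` of complex functions on the torus (for `s ≥ 0`). -/
def Sobolev (d : ℕ) (s : ℝ) : Type := sobolevSubmodule d s

namespace Sobolev

variable {d : ℕ} {s : ℝ}

instance : AddCommGroup (Sobolev d s) := inferInstanceAs (AddCommGroup (sobolevSubmodule d s))

instance : Module ℂ (Sobolev d s) := inferInstanceAs (Module ℂ (sobolevSubmodule d s))

/-- The inclusion of `Hˢ` in `L²`. -/
def toL2 : Sobolev d s →ₗ[ℂ] L2 d := (sobolevSubmodule d s).subtype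

theorem toL2_injective : Function.Injective (toL2 : Sobolev d s → L2 d) :=
  Subtype.val_injective

instance : CoeFun (Sobolev d s) fun _ => Torus d → ℂ := ⟨fun f => toL2 f⟩

theorem summable (f : Sobolev d s) : Summable fun k => weight s k * ‖fourierCoef f k‖ ^ 2 :=
  f.2

/-- The map `f ↦ ((1 + |k|²)^(s/2) f̂(k))ₖ` from `Hˢ` to `ℓ²`. -/
def weightedCoef : Sobolev d s →ₗ[ℂ] lp (fun _ : Fin d → ℤ => ℂ) 2 where
  toFun f := ⟨fun k => ((√(weight s k) : ℝ) : ℂ) * fourierCoef f k,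
    (memlp_iff s (fourierCoef f)).2 f.summable⟩
  map_add' f g := by
    ext k
    change _ * fourierCoef (toL2 f + toL2 g : L2 d) k = _ * _ + _ * _
    rw [fourierCoef_add, mul_add]
  map_smul' c f := by
    ext k
    change _ * fourierCoef (c • toL2 f : L2 d) k = c * (_ * _)
    rw [fourierCoef_smul, mul_left_comm]

theorem weightedCoef_apply (f : Sobolev d s) (k : Fin d → ℤ) :
    weightedCoef f k = ((√(weight s k) : ℝ) : ℂ) * fourierCoef f k := rfl

theorem ext_fourierCoef {f g : Sobolev d s} (h : ∀ k, fourierCoef f k = fourierCoef g k) :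
    f = g := by
  apply toL2_injective
  apply (charBasis d).repr.injective
  ext k
  rw [charBasis_repr, charBasis_repr, h k]

theorem weightedCoef_injective : Function.Injective (weightedCoef (d := d) (s := s)) := by
  intro f g h
  refine ext_fourierCoef fun k => ?_
  have hk := congrArg (fun a : lp (fun _ : Fin d → ℤ => ℂ) 2 => a k) h
  simp only [weightedCoef_apply] at hk
  refine mul_left_cancel₀ ?_ hk
  exact_mod_cast (Real.sqrt_pos.2 (weight_pos s k)).ne'

instance : NormedAddCommGroup (Sobolev d s) :=
  NormedAddCommGroup.induced (Sobolev d s) _ weightedCoef weightedCoef_injective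

instance : NormedSpace ℂ (Sobolev d s) :=
  NormedSpace.induced ℂ (Sobolev d s) (lp (fun _ : Fin d → ℤ => ℂ) 2) weightedCoef

/-- `‖f‖ₛ² = ∑ (1 + |k|²)ˢ |f̂(k)|²`. -/
theorem norm_sq_eq (f : Sobolev d s) :
    ‖f‖ ^ 2 = ∑' k, weight s k * ‖fourierCoef f k‖ ^ 2 := by
  have h := lp.norm_rpow_eq_tsum (p := 2) (by simp) (weightedCoef f)
  simp only [ENNReal.toReal_ofNat, Real.rpow_two, weightedCoef_apply,
    norm_sqrt_weight_mul_sq] at h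
  exact h

/-- A square summable and `s`-weighted square summable family of coefficients defines an element
of `Hˢ`. -/
theorem exists_fourierCoef_eq (a : (Fin d → ℤ) → ℂ) (h0 : Summable fun k => ‖a k‖ ^ 2)
    (hs : Summable fun k => weight s k * ‖a k‖ ^ 2) :
    ∃ f : Sobolev d s, ∀ k, fourierCoef f k = a k := by
  have ha : Memℓp a 2 := by
    rw [memℓp_gen_iff (by simp)]
    simpa using h0
  let g : L2 d := (charBasis d).repr.symm ⟨a, ha⟩
  have hg : ∀ k, fourierCoef g k = a k := fun k => by
    rw [← charBasis_repr]
    simp [g]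
  refine ⟨⟨g, ?_⟩, hg⟩
  change Summable fun k => weight s k * ‖fourierCoef g k‖ ^ 2
  simpa only [hg] using hs

theorem summable_zero_weight (f : Sobolev d s) : Summable fun k => ‖fourierCoef f k‖ ^ 2 := by
  have h := lp.memℓp ((charBasis d).repr (toL2 f))
  rw [memℓp_gen_iff (by simp)] at h
  simpa [charBasis_repr] using h

/-- For `s ≥ 0` the space `Hˢ` is complete. -/
theorem completeSpace (hs : 0 ≤ s) : CompleteSpace (Sobolev d s) := by
  have hiso : Isometry (weightedCoef : Sobolev d s → lp (fun _ : Fin d → ℤ => ℂ) 2) :=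
    AddMonoidHomClass.isometry_of_norm weightedCoef fun _ => rfl
  have hsurj : Function.Surjective
      (weightedCoef : Sobolev d s → lp (fun _ : Fin d → ℤ => ℂ) 2) := by
    intro b
    have hb : Summable fun k => ‖b k‖ ^ 2 := by
      have h := lp.memℓp b
      rw [memℓp_gen_iff (by simp)] at h
      simpa using h
    have hw : ∀ k : Fin d → ℤ, ((√(weight s k) : ℝ) : ℂ) ≠ 0 := fun k => by
      exact_mod_cast (Real.sqrt_pos.2 (weight_pos s k)).ne'
    have h2 : ∀ k, weight s k * ‖(((√(weight s k) : ℝ) : ℂ))⁻¹ * b k‖ ^ 2 = ‖b k‖ ^ 2 :=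
      fun k => by rw [← norm_sqrt_weight_mul_sq, mul_inv_cancel_left₀ (hw k)]
    have h1 : ∀ k : Fin d → ℤ, 1 ≤ weight s k := fun k =>
      Real.one_le_rpow (by linarith [sqNorm_nonneg k]) hs
    obtain ⟨f, hf⟩ := exists_fourierCoef_eq (s := s)
      (fun k => (((√(weight s k) : ℝ) : ℂ))⁻¹ * b k)
      (Summable.of_nonneg_of_le (fun _ => by positivity)
        (fun k => (le_mul_of_one_le_left (by positivity) (h1 k)).trans (h2 k).le) hb)
      (by simpa only [h2] using hb)
    refine ⟨f, ?_⟩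
    ext k
    rw [weightedCoef_apply, hf, mul_inv_cancel_left₀ (hw k)]
  exact (completeSpace_iff_isComplete_range hiso.isUniformInducing).2
    (by rw [hsurj.range_eq]; exact isComplete_univ)

end Sobolev

/-! The linear semigroup and the mild formulation. -/

/-- The Fourier symbol of `exp (t (V + (1 + iν) Δ))`. -/
def symbol {d : ℕ} (V ν : ℝ) (t : ℝ≥0) (k : Fin d → ℤ) : ℂ :=
  Complex.exp (((V : ℂ) - (1 + Complex.I * ν) * (sqNorm k : ℝ)) * ((t : ℝ) : ℂ))

theorem norm_symbol_le {d : ℕ} (V ν : ℝ) (t : ℝ≥0) (k : Fin d → ℤ) :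
    ‖symbol V ν t k‖ ≤ Real.exp (V * t) := by
  rw [symbol, Complex.norm_exp]
  apply Real.exp_le_exp.2
  have h : ((((V : ℂ) - (1 + Complex.I * ν) * (sqNorm k : ℝ)) * ((t : ℝ) : ℂ))).re =
      V * t - sqNorm k * t := by
    simp; ring
  rw [h]
  have := mul_nonneg (sqNorm_nonneg k) t.2
  simp only [NNReal.val_eq_coe] at this
  linarith

theorem exists_semigroup {d : ℕ} {s : ℝ} (V ν : ℝ) (t : ℝ≥0) (f : Sobolev d s) :
    ∃ g : Sobolev d s, ∀ k, fourierCoef g k = symbol V ν t k * fourierCoef f k := by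
  have hle : ∀ k, ‖symbol V ν t k * fourierCoef f k‖ ^ 2 ≤
      Real.exp (V * t) ^ 2 * ‖fourierCoef f k‖ ^ 2 := fun k => by
    rw [norm_mul, mul_pow]
    gcongr
    exact norm_symbol_le V ν t k
  refine Sobolev.exists_fourierCoef_eq _
    (Summable.of_nonneg_of_le (fun _ => by positivity) hle
      (f.summable_zero_weight.mul_left _))
    (Summable.of_nonneg_of_le
      (fun k => mul_nonneg (weight_pos s k).le (by positivity)) (fun k => ?_)
      (f.summable.mul_left (Real.exp (V * t) ^ 2)))
  calc weight s k * ‖symbol V ν t k * fourierCoef f k‖ ^ 2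
      ≤ weight s k * (Real.exp (V * t) ^ 2 * ‖fourierCoef f k‖ ^ 2) :=
        mul_le_mul_of_nonneg_left (hle k) (weight_pos s k).le
    _ = _ := by ring

/-- The semigroup `S(t) = exp (t (V + (1 + iν) Δ))` on `Hˢ`, i.e. the operator that multiplies the
`k`-th Fourier coefficient by `exp ((V - (1 + iν) |k|²) t)`. -/
def semigroup {d : ℕ} {s : ℝ} (V ν : ℝ) (t : ℝ≥0) (f : Sobolev d s) : Sobolev d s :=
  (exists_semigroup V ν t f).choose

theorem fourierCoef_semigroup {d : ℕ} {s : ℝ} (V ν : ℝ) (t : ℝ≥0) (f : Sobolev d s)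
    (k : Fin d → ℤ) :
    fourierCoef (semigroup V ν t f) k = symbol V ν t k * fourierCoef f k :=
  (exists_semigroup V ν t f).choose_spec k

/-- The function `-(1 + iμ) |ψ|^{2σ} ψ + (r₁ + i r₂) ⟨u, Q⟩ ψ` on the torus, for a control value
`u ∈ ℝ^q`. -/
def nonlinearity {d q : ℕ} (μ r₁ r₂ : ℝ) (σ : ℕ) (Q : Torus d → EuclideanSpace ℝ (Fin q))
    (u : EuclideanSpace ℝ (Fin q)) (ψ : Torus d → ℂ) (x : Torus d) : ℂ :=
  -(1 + Complex.I * μ) * ((‖ψ x‖ ^ (2 * σ) : ℝ) : ℂ) * ψ x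
    + (r₁ + Complex.I * r₂) * ((inner ℝ u (Q x) : ℝ) : ℂ) * ψ x

/-- `ψ ∈ C([0,T]; Hˢ)` is a (mild) solution on `[0,T]` of
`∂ₜψ = Vψ + (1 + iν) Δψ - (1 + iμ) |ψ|^{2σ} ψ + (r₁ + i r₂) ⟨u(t), Q⟩ ψ`, `ψ(0) = ψ₀`:
`ψ(t) = S(t) ψ₀ + ∫₀ᵗ S(t - τ) F(τ) dτ`, where `F(τ) ∈ Hˢ` is the nonlinear part of the equation
at time `τ` and the integral is a Bochner integral in `Hˢ`. Only the values of `ψ` on `[0,T]`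
matter. -/
def IsMildSolution {d q : ℕ} {s : ℝ} (V ν μ r₁ r₂ : ℝ) (σ : ℕ)
    (Q : Torus d → EuclideanSpace ℝ (Fin q)) (ψ₀ : Sobolev d s)
    (u : ℝ → EuclideanSpace ℝ (Fin q)) (T : ℝ) (ψ : ℝ → Sobolev d s) : Prop :=
  ContinuousOn ψ (Icc 0 T) ∧
  ∃ F : ℝ → Sobolev d s,
    (∀ τ ∈ Icc 0 T, F τ =ᵐ[torusMeasure d] nonlinearity μ r₁ r₂ σ Q (u τ) (ψ τ)) ∧
    ∀ t ∈ Icc 0 T,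
      IntervalIntegrable (fun τ => semigroup V ν (t - τ).toNNReal (F τ)) volume 0 t ∧
      ψ t = semigroup V ν t.toNNReal ψ₀
        + ∫ τ in (0 : ℝ)..t, semigroup V ν (t - τ).toNNReal (F τ)

/-- A field on the torus is smooth if its `2π`-periodic lift to `ℝᵈ` is. -/
def SmoothField {d q : ℕ} (Q : Torus d → EuclideanSpace ℝ (Fin q)) : Prop :=
  ContDiff ℝ ∞ fun x : Fin d → ℝ => Q fun i => (x i : AddCircle (2 * π))

/-- `u ∈ L²([0,T]; E)`. -/
def MemL2 {E : Type*} [NormedAddCommGroup E] (T : ℝ) (u : ℝ → E) : Prop :=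
  MemLp u 2 (volume.restrict (Icc 0 T))

/-- The norm of `L²([0,T]; E)`. -/
def normL2 {E : Type*} [NormedAddCommGroup E] (T : ℝ) (u : ℝ → E) : ℝ :=
  (eLpNorm u 2 (volume.restrict (Icc 0 T))).toReal

/-- The norm of `C([0,T]; E)`. -/
def normC {E : Type*} [NormedAddCommGroup E] (T : ℝ) (f : ℝ → E) : ℝ :=
  sSup ((fun t => ‖f t‖) '' Icc 0 T)

end CGL

end

/-! The equation is reduced to an abstract semilinear problem `ψ' = Aψ + N(ψ) + B(u)ψ` on a Banach
space, with a strongly continuous semigroup, `N` Lipschitz on balls and `B` bounded bilinear. Two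
facts about `Hˢ` with `s > d/2` make the reduction possible. Convolution preserves the weighted `ℓ²`
condition, so `Hˢ` is an algebra (`weighted_convolution`, `exists_mul`); as `σ` is an integer,
`|ψ|^{2σ}ψ` is a polynomial in `ψ` and its conjugate, hence bounded and Lipschitz on balls
(`actsOn_power`). Smooth functions lie in `Hˢ`, so multiplication by `⟨u, Q⟩` is a bounded operator
linear in `u` (`exists_control_operator`).

For the abstract problem, if `N` is globally Lipschitz, the Duhamel map is a contraction on all of
`[0, T]` in the sup norm weighted by `exp (-lτ)`, once `l` is large. A coefficient `‖u‖` that is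
only `L²` does no harm: Cauchy–Schwarz against the exponential gains `1/√l`
(`MemL2.integral_weight_le`, `norm_duhamel_le`). The same estimate, with half of the weighted
maximum absorbed on the left, gives Lipschitz dependence on the data (`IsSol.norm_sub_le`).

A general `N` is composed with the radial retraction onto a ball, which makes it globally Lipschitz.
Solutions staying in the ball are the same for both problems (`isSol_trunc_iff`). Uniqueness,
continuation and stability all follow by comparing with a truncated problem, whose solutions are
global. For stability the radius exceeds the size of the reference solution by `1`, and `δ` is so
small that perturbed solutions do not use up this margin.

For blow-up, if the norm did not tend to infinity, it would be below some `M` at times arbitrarily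
close to the final time. The time an orbit needs to leave a larger ball is bounded below in terms of
`M`, so the solution would stay bounded and extend, contradicting maximality. -/

namespace CGL

/-! Weights. -/

theorem weight_neg {d : ℕ} (s : ℝ) (k : Fin d → ℤ) : weight s (-k) = weight s k := by
  simp [weight, sqNorm]

theorem norm_intCast_sq_le_sqNorm {d : ℕ} (k : Fin d → ℤ) :
    ‖fun i => (k i : ℝ)‖ ^ 2 ≤ sqNorm k := by
  have h : ‖fun i => (k i : ℝ)‖ ≤ √(sqNorm k) := by
    refine (pi_norm_le_iff_of_nonneg (Real.sqrt_nonneg _)).2 fun i => ?_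
    refine Real.le_sqrt_of_sq_le ?_
    rw [Real.norm_eq_abs, sq_abs]
    exact Finset.single_le_sum (f := fun i => (k i : ℝ) ^ 2) (fun _ _ => sq_nonneg _)
      (Finset.mem_univ i)
  calc _ ≤ √(sqNorm k) ^ 2 := by gcongr
    _ = _ := Real.sq_sqrt (sqNorm_nonneg k)

/-- Comparison with `∑ ‖k‖^(-2s)` over the lattice `ℤᵈ`, which converges because its rank `d` is
less than `2s`. The sup norm there is at most the Euclidean one. -/
theorem summable_inv_weight {d : ℕ} {s : ℝ} (hs : (d : ℝ) / 2 < s) :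
    Summable fun k : Fin d → ℤ => (weight s k)⁻¹ := by
  let b := Pi.basisFun ℝ (Fin d)
  let L := Submodule.span ℤ (Set.range b)
  have hL : Module.finrank ℤ L = d := by
    rw [ZLattice.rank ℝ L]; simp
  have hsum := ZLattice.summable_norm_rpow L (-(2 * s)) (by rw [hL]; linarith)
  have hmem : ∀ k : Fin d → ℤ, (fun i => (k i : ℝ)) ∈ L := fun k => by
    have : (fun i => (k i : ℝ)) = ∑ i, k i • b i := by
      ext j
      simp [b, Pi.single_apply]
    rw [this]
    exact Submodule.sum_mem _ fun i _ =>
      Submodule.smul_mem _ _ (Submodule.subset_span ⟨i, rfl⟩)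
  let e : (Fin d → ℤ) → L := fun k => ⟨fun i => (k i : ℝ), hmem k⟩
  have he : Function.Injective e := fun k l h => by
    ext i
    have : (k i : ℝ) = l i := congrFun (congrArg Subtype.val h) i
    exact_mod_cast this
  refine Summable.of_norm_bounded_eventually (hsum.comp_injective he) ?_
  -- The comparison fails at `k = 0`, where the real power is `0` by convention and the inverse
  -- weight is `1`.
  filter_upwards [(Set.finite_singleton (0 : Fin d → ℤ)).compl_mem_cofinite] with k hk
  have hs0 : 0 ≤ s := le_trans (by positivity) hs.le
  have hpos : 0 < ‖fun i => (k i : ℝ)‖ := by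
    refine norm_pos_iff.2 fun h => hk ?_
    ext i
    have : (k i : ℝ) = 0 := congrFun h i
    simpa using this
  rw [norm_inv, Real.norm_eq_abs, abs_of_pos (weight_pos s k)]
  change _ ≤ ‖fun i => (k i : ℝ)‖ ^ (-(2 * s))
  rw [Real.rpow_neg hpos.le, Real.rpow_mul hpos.le, Real.rpow_two]
  refine inv_anti₀ (by positivity) ?_
  refine Real.rpow_le_rpow (by positivity) ?_ hs0
  linarith [norm_intCast_sq_le_sqNorm k]

/-- If `|k| ≤ |l|`, then `1 + |k + l|² ≤ 1 + 2|k|² + 2|l|² ≤ 4 (1 + |l|²)`. -/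
theorem weight_add_le {d : ℕ} {s : ℝ} (hs : 0 ≤ s) (k l : Fin d → ℤ) :
    weight s (k + l) ≤ 4 ^ s * (weight s k + weight s l) := by
  wlog h : sqNorm k ≤ sqNorm l generalizing k l
  · rw [add_comm k, add_comm (weight s k)]
    exact this l k (le_of_not_ge h)
  have h1 : sqNorm (k + l) ≤ 2 * sqNorm k + 2 * sqNorm l := by
    simp only [sqNorm, Finset.mul_sum, ← Finset.sum_add_distrib]
    refine Finset.sum_le_sum fun i _ => ?_
    simp only [Pi.add_apply, Int.cast_add]
    nlinarith [sq_nonneg ((k i : ℝ) - l i)]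
  calc weight s (k + l) ≤ (4 * (1 + sqNorm l)) ^ s := by
        refine Real.rpow_le_rpow ?_ ?_ hs
        · linarith [sqNorm_nonneg (k + l)]
        · linarith
    _ = 4 ^ s * weight s l := Real.mul_rpow (by norm_num) (by linarith [sqNorm_nonneg l])
    _ ≤ _ := by
        have := (weight_pos s k).le
        gcongr
        linarith

theorem one_le_weight {d : ℕ} {s : ℝ} (hs : 0 ≤ s) (k : Fin d → ℤ) : 1 ≤ weight s k :=
  Real.one_le_rpow (by linarith [sqNorm_nonneg k]) hs

theorem weight_mul_inv_le {d : ℕ} {s : ℝ} (hs : 0 ≤ s) (k l : Fin d → ℤ) :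
    weight s k * (weight s l * weight s (k - l))⁻¹ ≤
      4 ^ s * ((weight s l)⁻¹ + (weight s (k - l))⁻¹) := by
  have h1 := weight_pos s l
  have h2 := weight_pos s (k - l)
  have h := weight_add_le hs l (k - l)
  rw [add_sub_cancel] at h
  calc _ ≤ 4 ^ s * (weight s l + weight s (k - l)) * (weight s l * weight s (k - l))⁻¹ := by
        gcongr
    _ = _ := by field_simp; ring

/-! ### Cauchy–Schwarz and weighted convolution. -/

theorem tsum_mul_sq_le {ι : Type*} {f g : ι → ℝ} (hf : ∀ i, 0 ≤ f i) (hg : ∀ i, 0 ≤ g i)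
    (hf2 : Summable fun i => f i ^ 2) (hg2 : Summable fun i => g i ^ 2) :
    Summable (fun i => f i * g i) ∧
      (∑' i, f i * g i) ^ 2 ≤ (∑' i, f i ^ 2) * ∑' i, g i ^ 2 := by
  have hpq : (2 : ℝ).HolderConjugate 2 := Real.HolderConjugate.two_two
  have h1 := Real.summable_mul_of_Lp_Lq_of_nonneg hpq hf hg (by simpa using hf2) (by simpa using hg2)
  have h2 := Real.inner_le_Lp_mul_Lq_tsum_of_nonneg hpq hf hg (by simpa using hf2)
    (by simpa using hg2)
  refine ⟨h1, ?_⟩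
  simp only [Real.rpow_two] at h2
  rw [← Real.sqrt_eq_rpow, ← Real.sqrt_eq_rpow] at h2
  have hA : 0 ≤ ∑' i, f i ^ 2 := tsum_nonneg fun _ => sq_nonneg _
  have hB : 0 ≤ ∑' i, g i ^ 2 := tsum_nonneg fun _ => sq_nonneg _
  calc _ ≤ (√(∑' i, f i ^ 2) * √(∑' i, g i ^ 2)) ^ 2 :=
        pow_le_pow_left₀ (tsum_nonneg fun i => mul_nonneg (hf i) (hg i)) h2 2
    _ = _ := by rw [mul_pow, Real.sq_sqrt hA, Real.sq_sqrt hB]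

theorem summable_inv_weight_sub {d : ℕ} {s : ℝ} (hs : (d : ℝ) / 2 < s) (k : Fin d → ℤ) :
    Summable fun l => (weight s (k - l))⁻¹ :=
  ((Equiv.subLeft k).summable_iff (f := fun l => (weight s l)⁻¹)).2 (summable_inv_weight hs)

theorem tsum_inv_weight_sub {d : ℕ} (s : ℝ) (k : Fin d → ℤ) :
    ∑' l, (weight s (k - l))⁻¹ = ∑' l : Fin d → ℤ, (weight s l)⁻¹ :=
  (Equiv.subLeft k).tsum_eq fun l => (weight s l)⁻¹

theorem summable_inv_weight_mul {d : ℕ} {s : ℝ} (hs : (d : ℝ) / 2 < s) (k : Fin d → ℤ) :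
    Summable fun l => (weight s l * weight s (k - l))⁻¹ := by
  have hs0 : 0 ≤ s := le_trans (by positivity) hs.le
  refine Summable.of_nonneg_of_le (f := fun l => (weight s l)⁻¹) (fun l => ?_) (fun l => ?_)
    (summable_inv_weight hs)
  · exact (inv_pos.2 (mul_pos (weight_pos _ _) (weight_pos _ _))).le
  · exact inv_anti₀ (weight_pos s l)
      (le_mul_of_one_le_right (weight_pos s l).le (one_le_weight hs0 _))

theorem weight_mul_tsum_inv_le {d : ℕ} {s : ℝ} (hs : (d : ℝ) / 2 < s) (k : Fin d → ℤ) :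
    weight s k * ∑' l, (weight s l * weight s (k - l))⁻¹ ≤
      4 ^ s * (2 * ∑' l : Fin d → ℤ, (weight s l)⁻¹) := by
  have hs0 : 0 ≤ s := le_trans (by positivity) hs.le
  have h := summable_inv_weight hs
  have h' := summable_inv_weight_sub hs k
  have h1 := (summable_inv_weight_mul hs k).mul_left (weight s k)
  have h2 := (h.add h').mul_left ((4 : ℝ) ^ s)
  rw [← tsum_mul_left]
  refine (h1.tsum_le_tsum (weight_mul_inv_le hs0 k) h2).trans_eq ?_
  rw [tsum_mul_left, h.tsum_add h', tsum_inv_weight_sub, two_mul]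

/-- Weighted Young inequality: the convolution maps `hˢ × hˢ` to `hˢ` for `s > d/2`. -/
theorem weighted_convolution {d : ℕ} {s : ℝ} (hs : (d : ℝ) / 2 < s) {a b : (Fin d → ℤ) → ℝ}
    (ha : ∀ k, 0 ≤ a k) (hb : ∀ k, 0 ≤ b k) (has : Summable fun k => weight s k * a k ^ 2)
    (hbs : Summable fun k => weight s k * b k ^ 2) :
    (Summable fun k => weight s k * (∑' l, a l * b (k - l)) ^ 2) ∧
      ∑' k, weight s k * (∑' l, a l * b (k - l)) ^ 2 ≤
        (4 ^ s * (2 * ∑' k : Fin d → ℤ, (weight s k)⁻¹)) *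
          ((∑' k, weight s k * a k ^ 2) * ∑' k, weight s k * b k ^ 2) := by
  have hs0 : 0 ≤ s := le_trans (by positivity) hs.le
  set W := ∑' k : Fin d → ℤ, (weight s k)⁻¹
  set p : (Fin d → ℤ) → ℝ := fun k => weight s k * a k ^ 2
  set r : (Fin d → ℤ) → ℝ := fun k => weight s k * b k ^ 2
  have hp : ∀ k, 0 ≤ p k := fun k => mul_nonneg (weight_pos s k).le (sq_nonneg _)
  have hr : ∀ k, 0 ≤ r k := fun k => mul_nonneg (weight_pos s k).le (sq_nonneg _)
  -- The change of variables `(k, l) ↦ (l, k - l)` turns the double sum of `p(l) r(k - l)` into a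
  -- product of two sums.
  let e : (Fin d → ℤ) × (Fin d → ℤ) ≃ (Fin d → ℤ) × (Fin d → ℤ) :=
    { toFun := fun x => (x.2, x.1 - x.2)
      invFun := fun x => (x.1 + x.2, x.1)
      left_inv := fun x => by ext <;> simp
      right_inv := fun x => by ext <;> simp }
  have hpr : Summable fun x : (Fin d → ℤ) × (Fin d → ℤ) => p x.1 * r x.2 :=
    has.mul_of_nonneg hbs hp hr
  have hpr' : Summable fun x : (Fin d → ℤ) × (Fin d → ℤ) => p x.2 * r (x.1 - x.2) :=
    e.summable_iff.2 hpr
  have hfac := hpr'.prod_factor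
  have hout : Summable fun k => ∑' l, p l * r (k - l) := hpr'.prod
  have hval : ∑' k, ∑' l, p l * r (k - l) = (∑' k, p k) * ∑' k, r k := by
    rw [has.tsum_mul_tsum hbs hpr, ← e.tsum_eq]
    exact hpr'.tsum_prod.symm
  have key : ∀ k, weight s k * (∑' l, a l * b (k - l)) ^ 2 ≤
      (4 ^ s * (2 * W)) * ∑' l, p l * r (k - l) := by
    intro k
    -- Cauchy–Schwarz after dividing and multiplying `a(l) b(k - l)` by the square root of both
    -- weights. The first factor, times `weight s k`, is bounded uniformly in `k`.
    have hcs := tsum_mul_sq_le (f := fun l => √((weight s l * weight s (k - l))⁻¹))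
      (g := fun l => √(p l * r (k - l))) (fun _ => Real.sqrt_nonneg _)
      (fun _ => Real.sqrt_nonneg _)
    have e1 : ∀ l, √((weight s l * weight s (k - l))⁻¹) ^ 2 =
      (weight s l * weight s (k - l))⁻¹ := fun l => Real.sq_sqrt (by
        have := weight_pos s l; have := weight_pos s (k - l)
        positivity)
    have e2 : ∀ l, √(p l * r (k - l)) ^ 2 = p l * r (k - l) := fun l =>
      Real.sq_sqrt (mul_nonneg (hp _) (hr _))
    have e3 : ∀ l, √((weight s l * weight s (k - l))⁻¹) * √(p l * r (k - l)) =
        a l * b (k - l) := fun l => by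
      have h1 := weight_pos s l; have h2 := weight_pos s (k - l)
      rw [← Real.sqrt_mul (by positivity)]
      have : (weight s l * weight s (k - l))⁻¹ * (p l * r (k - l)) = (a l * b (k - l)) ^ 2 := by
        simp only [p, r]
        field_simp
      rw [this, Real.sqrt_sq (mul_nonneg (ha _) (hb _))]
    simp only [e1, e2, e3] at hcs
    have hcs := (hcs (summable_inv_weight_mul hs k) (hfac k)).2
    calc weight s k * (∑' l, a l * b (k - l)) ^ 2
        ≤ weight s k * ((∑' l, (weight s l * weight s (k - l))⁻¹) * ∑' l, p l * r (k - l)) :=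
          mul_le_mul_of_nonneg_left hcs (weight_pos s k).le
      _ = (weight s k * ∑' l, (weight s l * weight s (k - l))⁻¹) * ∑' l, p l * r (k - l) := by
          rw [mul_assoc]
      _ ≤ _ := mul_le_mul_of_nonneg_right (weight_mul_tsum_inv_le hs k)
            (tsum_nonneg fun l => mul_nonneg (hp _) (hr _))
  have hsum : Summable fun k => weight s k * (∑' l, a l * b (k - l)) ^ 2 :=
    Summable.of_nonneg_of_le (fun k => mul_nonneg (weight_pos s k).le (sq_nonneg _)) key
      (hout.mul_left _)
  refine ⟨hsum, ?_⟩
  rw [← hval, ← tsum_mul_left]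
  exact hsum.tsum_le_tsum key (hout.mul_left _)

/-! ### Fourier coefficients of conjugates and products. -/

theorem norm_char_apply {d : ℕ} (k : Fin d → ℤ) (x : Torus d) : ‖char k x‖ = 1 := by
  simp only [char, ContinuousMap.coe_mk, norm_prod]
  exact Finset.prod_eq_one fun i _ => Circle.norm_coe _

theorem norm_char_le {d : ℕ} (k : Fin d → ℤ) : ‖char k‖ ≤ 1 :=
  (ContinuousMap.norm_le _ zero_le_one).2 fun x => (norm_char_apply k x).le

theorem fourierCoef_congr_ae {d : ℕ} {f g : Torus d → ℂ} (h : f =ᵐ[torusMeasure d] g)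
    (k : Fin d → ℤ) : fourierCoef f k = fourierCoef g k :=
  integral_congr_ae (h.mono fun x hx => by simp only [hx])

theorem fourierCoef_conj {d : ℕ} (f : Torus d → ℂ) (k : Fin d → ℤ) :
    fourierCoef (fun x => conj (f x)) k = conj (fourierCoef f (-k)) := by
  rw [fourierCoef, fourierCoef, ← integral_conj]
  refine integral_congr_ae (Eventually.of_forall fun x => ?_)
  simp only [map_mul]
  rw [← char_neg, neg_neg]

theorem fourierCoef_mul_char {d : ℕ} (f : Torus d → ℂ) (k l : Fin d → ℤ) :
    fourierCoef (fun x => char l x * f x) k = fourierCoef f (k - l) := by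
  refine integral_congr_ae (Eventually.of_forall fun x => ?_)
  simp only
  rw [show -(k - l) = l + -k by abel, char_add]
  ring

/-- Absolute convergence permits termwise integration, and each character shifts the frequency of
`g`; multiplication thus becomes convolution. -/
theorem fourierCoef_tsum_mul {d : ℕ} {a : (Fin d → ℤ) → ℂ} (ha : Summable fun k => ‖a k‖)
    {g : Torus d → ℂ} (hg : Integrable g (torusMeasure d)) (k : Fin d → ℤ) :
    fourierCoef (fun x => (∑' l, a l * char l x) * g x) k =
      ∑' l, a l * fourierCoef g (k - l) := by
  have hint : ∀ l, Integrable (fun x => a l * (char l x * g x * char (-k) x))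
      (torusMeasure d) := fun l => by
    refine Integrable.const_mul ?_ _
    refine Integrable.mul_bdd (c := 1) ?_ (char (-k)).continuous.aestronglyMeasurable
      (Eventually.of_forall fun x => (norm_char_apply _ x).le)
    exact hg.bdd_mul (c := 1) (char l).continuous.aestronglyMeasurable
      (Eventually.of_forall fun x => (norm_char_apply _ x).le)
  have hn : ∀ l x, ‖a l * (char l x * g x * char (-k) x)‖ = ‖a l‖ * ‖g x‖ := fun l x => by
    simp [norm_char_apply]
  have h := (hasSum_integral_of_summable_integral_norm hint (by
    simp only [hn, integral_const_mul]
    exact ha.mul_right _)).tsum_eq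
  simp only [integral_const_mul] at h
  rw [fourierCoef]
  have h1 : ∀ l, a l * fourierCoef g (k - l) =
      a l * ∫ x, char l x * g x * char (-k) x ∂torusMeasure d := fun l => by
    rw [← fourierCoef_mul_char]; rfl
  simp only [h1, h]
  refine integral_congr_ae (Eventually.of_forall fun x => ?_)
  simp only
  rw [mul_assoc, ← tsum_mul_right]
  exact tsum_congr fun l => by ring

/-! ### The algebra `Hˢ` and its polynomial maps. -/

namespace Sobolev

variable {d : ℕ} {s : ℝ}

theorem ext_ae {f g : Sobolev d s} (h : f =ᵐ[torusMeasure d] g) : f = g :=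
  toL2_injective (Lp.ext h)

theorem coeFn_add (f g : Sobolev d s) :
    (f + g : Sobolev d s) =ᵐ[torusMeasure d] fun x => f x + g x := by
  rw [map_add]; exact Lp.coeFn_add _ _

theorem coeFn_sub (f g : Sobolev d s) :
    (f - g : Sobolev d s) =ᵐ[torusMeasure d] fun x => f x - g x := by
  rw [map_sub]; exact Lp.coeFn_sub _ _

theorem coeFn_smul (c : ℂ) (f : Sobolev d s) :
    (c • f : Sobolev d s) =ᵐ[torusMeasure d] fun x => c * f x := by
  rw [map_smul]; exact Lp.coeFn_smul _ _

theorem memLp (f : Sobolev d s) : MemLp f 2 (torusMeasure d) := Lp.memLp _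

theorem exists_ae_eq {g : Torus d → ℂ} (hg : MemLp g 2 (torusMeasure d))
    (h : Summable fun k => weight s k * ‖fourierCoef g k‖ ^ 2) :
    ∃ f : Sobolev d s, f =ᵐ[torusMeasure d] g := by
  have hc : ∀ k, fourierCoef (hg.toLp g) k = fourierCoef g k :=
    fourierCoef_congr_ae hg.coeFn_toLp
  refine ⟨⟨hg.toLp g, ?_⟩, hg.coeFn_toLp⟩
  change Summable fun k => weight s k * ‖fourierCoef (hg.toLp g) k‖ ^ 2
  simpa only [hc] using h

/-- Cauchy–Schwarz with the factors `(1 + |k|²)^(-s/2)` and `(1 + |k|²)^(s/2) |f̂(k)|`. This is the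
Sobolev embedding: the Fourier series converges uniformly. -/
theorem summable_norm_fourierCoef (hs : (d : ℝ) / 2 < s) (f : Sobolev d s) :
    Summable fun k => ‖fourierCoef f k‖ := by
  have h := (tsum_mul_sq_le (f := fun k : Fin d → ℤ => √((weight s k)⁻¹))
    (g := fun k => √(weight s k) * ‖fourierCoef f k‖) (fun _ => Real.sqrt_nonneg _)
    (fun _ => by positivity) ?_ ?_).1
  · refine h.congr fun k => ?_
    rw [Real.sqrt_inv, inv_mul_cancel_left₀ (Real.sqrt_pos.2 (weight_pos s k)).ne']
  · simpa only [Real.sq_sqrt (inv_pos.2 (weight_pos s _)).le] using summable_inv_weight hs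
  · simpa only [mul_pow, Real.sq_sqrt (weight_pos s _).le] using f.summable

theorem summable_smul_char {a : (Fin d → ℤ) → ℂ} (ha : Summable fun k => ‖a k‖) :
    Summable fun k => a k • char k := by
  refine Summable.of_norm_bounded ha fun k => ?_
  rw [norm_smul]
  exact mul_le_of_le_one_right (norm_nonneg _) (norm_char_le k)

/-- For `s > d/2` the elements of `Hˢ` are the sums of their Fourier series. -/
theorem ae_eq_tsum (hs : (d : ℝ) / 2 < s) (f : Sobolev d s) :
    f =ᵐ[torusMeasure d] (∑' k, fourierCoef f k • char k : C(Torus d, ℂ)) := by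
  have h := (summable_smul_char (summable_norm_fourierCoef hs f)).hasSum
  have h1 := h.map (ContinuousMap.toLp (E := ℂ) 2 (torusMeasure d) ℂ)
    (ContinuousLinearMap.continuous _)
  have h2 := (charBasis d).hasSum_repr (toL2 f)
  have h3 : (fun k => ((charBasis d).repr (toL2 f) : (Fin d → ℤ) → ℂ) k • charBasis d k) =
      (ContinuousMap.toLp (E := ℂ) 2 (torusMeasure d) ℂ) ∘
        fun k => fourierCoef f k • char k := by
    ext1 k
    rw [charBasis_repr]
    simp [charBasis]
  rw [h3] at h2
  have h4 := h2.unique h1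
  refine EventuallyEq.trans (Eventually.of_forall fun x => ?_)
    (ContinuousMap.coeFn_toLp (p := 2) (𝕜 := ℂ) (torusMeasure d) (∑' k, fourierCoef f k • char k : C(Torus d, ℂ)))
  exact congrArg (fun g : L2 d => g x) h4

theorem ae_eq_tsum_apply (hs : (d : ℝ) / 2 < s) (f : Sobolev d s) :
    f =ᵐ[torusMeasure d] fun x => ∑' k, fourierCoef f k * char k x := by
  refine (ae_eq_tsum hs f).trans (Eventually.of_forall fun x => ?_)
  have h := (summable_smul_char (summable_norm_fourierCoef hs f)).hasSum
  simpa using (ContinuousMap.hasSum_apply h x).tsum_eq.symm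

/-- For `s > d/2` the space `Hˢ` is an algebra. -/
theorem exists_mul (hs : (d : ℝ) / 2 < s) :
    ∃ c : ℝ, 0 ≤ c ∧ ∀ f g : Sobolev d s, ∃ h : Sobolev d s,
      h =ᵐ[torusMeasure d] (fun x => f x * g x) ∧ ‖h‖ ≤ c * ‖f‖ * ‖g‖ := by
  set c := 4 ^ s * (2 * ∑' k : Fin d → ℤ, (weight s k)⁻¹)
  have hc : 0 ≤ c := by
    have : 0 ≤ ∑' k : Fin d → ℤ, (weight s k)⁻¹ :=
      tsum_nonneg fun k => (inv_pos.2 (weight_pos s k)).le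
    positivity
  refine ⟨√c, Real.sqrt_nonneg _, fun f g => ?_⟩
  have hf := summable_norm_fourierCoef hs f
  have hg := summable_norm_fourierCoef hs g
  -- The product is in `L²` because `f` agrees a.e. with a continuous, hence bounded, function.
  have hmem : MemLp (fun x => f x * g x) 2 (torusMeasure d) := by
    refine MemLp.of_le_mul (c := ‖(∑' k, fourierCoef f k • char k : C(Torus d, ℂ))‖) g.memLp
      (f.memLp.1.mul g.memLp.1) ?_
    filter_upwards [ae_eq_tsum hs f] with x hx
    rw [norm_mul, hx]
    gcongr
    exact ContinuousMap.norm_coe_le_norm _ x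
  have hcoef : ∀ k, fourierCoef (fun x => f x * g x) k =
      ∑' l, fourierCoef f l * fourierCoef g (k - l) := fun k => by
    rw [← fourierCoef_tsum_mul hf (g.memLp.integrable (by norm_num))]
    refine fourierCoef_congr_ae ?_ k
    filter_upwards [ae_eq_tsum_apply hs f] with x hx
    rw [hx]
  have hle : ∀ k, ‖fourierCoef (fun x => f x * g x) k‖ ≤
      ∑' l, ‖fourierCoef f l‖ * ‖fourierCoef g (k - l)‖ := fun k => by
    rw [hcoef]
    refine (norm_tsum_le_tsum_norm ?_).trans_eq (tsum_congr fun l => norm_mul _ _)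
    refine Summable.of_nonneg_of_le (fun _ => norm_nonneg _) (fun l => ?_)
      (hf.mul_right (∑' l, ‖fourierCoef g l‖))
    rw [norm_mul]
    gcongr
    exact hg.le_tsum (k - l) fun _ _ => norm_nonneg _
  obtain ⟨hsum, hbd⟩ := weighted_convolution hs (a := fun k => ‖fourierCoef f k‖)
    (b := fun k => ‖fourierCoef g k‖) (fun _ => norm_nonneg _) (fun _ => norm_nonneg _)
    f.summable g.summable
  have hle2 : ∀ k, weight s k * ‖fourierCoef (fun x => f x * g x) k‖ ^ 2 ≤
      weight s k * (∑' l, ‖fourierCoef f l‖ * ‖fourierCoef g (k - l)‖) ^ 2 := fun k =>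
    mul_le_mul_of_nonneg_left (pow_le_pow_left₀ (norm_nonneg _) (hle k) 2) (weight_pos s k).le
  have hsum2 : Summable fun k => weight s k * ‖fourierCoef (fun x => f x * g x) k‖ ^ 2 :=
    Summable.of_nonneg_of_le (fun k => mul_nonneg (weight_pos s k).le (sq_nonneg _)) hle2 hsum
  obtain ⟨h, hh⟩ := exists_ae_eq hmem hsum2
  refine ⟨h, hh, ?_⟩
  refine le_of_sq_le_sq ?_ (by positivity)
  rw [mul_pow, mul_pow, Real.sq_sqrt hc, norm_sq_eq, norm_sq_eq f, norm_sq_eq g, mul_assoc]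
  simp only [fourierCoef_congr_ae hh]
  exact (hsum2.tsum_le_tsum hle2 hsum).trans hbd

theorem exists_conj (f : Sobolev d s) : ∃ h : Sobolev d s,
    h =ᵐ[torusMeasure d] (fun x => conj (f x)) ∧ ‖h‖ = ‖f‖ := by
  have hc : ∀ k, weight s k * ‖fourierCoef (fun x => conj (f x)) k‖ ^ 2 =
      weight s (-k) * ‖fourierCoef f (-k)‖ ^ 2 := fun k => by
    rw [fourierCoef_conj, RCLike.norm_conj, weight_neg]
  have hsum : Summable fun k => weight s k * ‖fourierCoef (fun x => conj (f x)) k‖ ^ 2 := by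
    simp only [hc]
    exact ((Equiv.neg _).summable_iff
      (f := fun k => weight s k * ‖fourierCoef f k‖ ^ 2)).2 f.summable
  obtain ⟨h, hh⟩ := exists_ae_eq f.memLp.star hsum
  refine ⟨h, hh, ?_⟩
  rw [← sq_eq_sq₀ (norm_nonneg _) (norm_nonneg _), norm_sq_eq, norm_sq_eq]
  simp only [fourierCoef_congr_ae hh]
  calc _ = ∑' k, weight s (-k) * ‖fourierCoef f (-k)‖ ^ 2 := tsum_congr hc
    _ = _ := (Equiv.neg _).tsum_eq fun k => weight s k * ‖fourierCoef f k‖ ^ 2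

/-- A map `Φ : ℂ → ℂ` acts on `Hˢ` by composition, bounded and Lipschitz on bounded sets. -/
def ActsOn (d : ℕ) (s : ℝ) (Φ : ℂ → ℂ) : Prop :=
  ∃ P : Sobolev d s → Sobolev d s, (∀ f, P f =ᵐ[torusMeasure d] fun x => Φ (f x)) ∧
    ∀ R : ℝ, ∃ L : ℝ, 0 ≤ L ∧ ∀ f g, ‖f‖ ≤ R → ‖g‖ ≤ R →
      ‖P f‖ ≤ L ∧ ‖P f - P g‖ ≤ L * ‖f - g‖

theorem actsOn_id : ActsOn d s fun z => z :=
  ⟨id, fun _ => .rfl, fun R => ⟨max R 1, by positivity, fun f g hf _ =>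
    ⟨hf.trans (le_max_left _ _), le_mul_of_one_le_left (norm_nonneg _) (le_max_right _ _)⟩⟩⟩

theorem actsOn_conj : ActsOn d s fun z => conj z := by
  choose P hP hn using exists_conj (d := d) (s := s)
  refine ⟨P, hP, fun R => ⟨max R 1, by positivity, fun f g hf _ =>
    ⟨(hn f).trans_le (hf.trans (le_max_left _ _)), ?_⟩⟩⟩
  have : P f - P g = P (f - g) := by
    apply ext_ae
    filter_upwards [coeFn_sub (P f) (P g), hP f, hP g, hP (f - g), coeFn_sub f g]
      with x h1 h2 h3 h4 h5
    rw [h1, h2, h3, h4, h5, map_sub]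
  rw [this, hn]
  exact le_mul_of_one_le_left (norm_nonneg _) (le_max_right _ _)

theorem ActsOn.const_mul {Φ : ℂ → ℂ} (h : ActsOn d s Φ) (c : ℂ) :
    ActsOn d s fun z => c * Φ z := by
  obtain ⟨P, hP, hL⟩ := h
  refine ⟨fun f => c • P f, fun f => ?_, fun R => ?_⟩
  · filter_upwards [coeFn_smul c (P f), hP f] with x h1 h2
    rw [h1, h2]
  · obtain ⟨L, hL0, hL⟩ := hL R
    refine ⟨‖c‖ * L, by positivity, fun f g hf hg => ?_⟩
    obtain ⟨h1, h2⟩ := hL f g hf hg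
    rw [← smul_sub, norm_smul, norm_smul, mul_assoc]
    constructor <;> gcongr

theorem ActsOn.mul (hs : (d : ℝ) / 2 < s) {Φ Ψ : ℂ → ℂ} (h : ActsOn d s Φ)
    (h' : ActsOn d s Ψ) : ActsOn d s fun z => Φ z * Ψ z := by
  obtain ⟨P, hP, hL⟩ := h
  obtain ⟨P', hP', hL'⟩ := h'
  obtain ⟨c, hc, hmul⟩ := exists_mul (d := d) hs
  choose m hm hmn using hmul
  refine ⟨fun f => m (P f) (P' f), fun f => ?_, fun R => ?_⟩
  · filter_upwards [hm (P f) (P' f), hP f, hP' f] with x h1 h2 h3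
    rw [h1, h2, h3]
  · obtain ⟨L, hL0, hL⟩ := hL R
    obtain ⟨L', hL0', hL'⟩ := hL' R
    -- The factor `2` counts the two terms of the telescoped difference `PfP'f - PgP'g`.
    refine ⟨c * L * L' * 2, by positivity, fun f g hf hg => ⟨?_, ?_⟩⟩
    · calc _ ≤ c * ‖P f‖ * ‖P' f‖ := hmn _ _
        _ ≤ c * L * L' := by
          gcongr
          exacts [(hL f g hf hg).1, (hL' f g hf hg).1]
        _ ≤ _ := le_mul_of_one_le_right (by positivity) (by norm_num)
    · have : m (P f) (P' f) - m (P g) (P' g) =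
          m (P f - P g) (P' f) + m (P g) (P' f - P' g) := by
        apply ext_ae
        filter_upwards [coeFn_sub (m (P f) (P' f)) (m (P g) (P' g)), hm (P f) (P' f),
          hm (P g) (P' g), coeFn_add (m (P f - P g) (P' f)) (m (P g) (P' f - P' g)),
          hm (P f - P g) (P' f), hm (P g) (P' f - P' g), coeFn_sub (P f) (P g),
          coeFn_sub (P' f) (P' g)] with x h1 h2 h3 h4 h5 h6 h7 h8
        rw [h1, h2, h3, h4, h5, h6, h7, h8]
        ring
      rw [this]
      calc _ ≤ c * ‖P f - P g‖ * ‖P' f‖ + c * ‖P g‖ * ‖P' f - P' g‖ :=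
            (norm_add_le _ _).trans (add_le_add (hmn _ _) (hmn _ _))
        _ ≤ c * (L * ‖f - g‖) * L' + c * L * (L' * ‖f - g‖) := by
          gcongr
          exacts [(hL f g hf hg).2, (hL' f g hf hg).1, (hL g f hg hf).1, (hL' f g hf hg).2]
        _ = _ := by ring

/-- Induction on `σ` through `|z|^{2(n+1)} z = (z z̄) · |z|^{2n} z`, so only products and
conjugation are needed. -/
theorem actsOn_power (hs : (d : ℝ) / 2 < s) (c : ℂ) (σ : ℕ) :
    ActsOn d s fun z => c * ((‖z‖ ^ (2 * σ) : ℝ) : ℂ) * z := by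
  suffices h : ActsOn d s fun z => ((‖z‖ ^ (2 * σ) : ℝ) : ℂ) * z by
    simpa only [mul_assoc] using h.const_mul c
  induction σ with
  | zero => simpa using actsOn_id
  | succ n ih =>
    have h := ((actsOn_id.mul hs actsOn_conj).mul hs ih)
    convert! h using 2 with z
    rw [Complex.mul_conj, Complex.normSq_eq_norm_sq]
    push_cast
    ring

end Sobolev

/-! ### Smooth functions on the torus and the control operator. -/

instance (d : ℕ) : (torusMeasure d).IsAddLeftInvariant := by
  unfold torusMeasure; infer_instance

/-- The covering map `ℝᵈ → ℝᵈ / 2πℤᵈ`. -/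
noncomputable def torusMk {d : ℕ} (x : Fin d → ℝ) : Torus d := fun i => (x i : AddCircle (2 * π))

theorem isOpenQuotientMap_torusMk (d : ℕ) : IsOpenQuotientMap (torusMk (d := d)) :=
  IsOpenQuotientMap.piMap fun _ : Fin d =>
    (QuotientAddGroup.isOpenQuotientMap_mk :
      IsOpenQuotientMap ((↑) : ℝ → AddCircle (2 * π)))

/-- Smooth complex functions on the torus. -/
def SmoothFun {d : ℕ} (f : Torus d → ℂ) : Prop := ContDiff ℝ ∞ (f ∘ torusMk)

theorem SmoothFun.continuous {d : ℕ} {f : Torus d → ℂ} (hf : SmoothFun f) : Continuous f :=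
  (isOpenQuotientMap_torusMk d).isQuotientMap.continuous_iff.2 (ContDiff.continuous hf)

theorem integrable_of_continuous {d : ℕ} {f : Torus d → ℂ} (hf : Continuous f) :
    Integrable f (torusMeasure d) :=
  hf.integrable_of_hasCompactSupport (HasCompactSupport.of_compactSpace f)

theorem torusMk_add_single {d : ℕ} (x : Fin d → ℝ) (i : Fin d) (h : ℝ) :
    torusMk x + Pi.single i (h : AddCircle (2 * π)) = torusMk (x + h • Pi.single i 1) := by
  ext j
  by_cases hj : j = i
  · subst hj; simp [torusMk]
  · simp [torusMk, hj]

/-- The `i`-th partial derivative of a function on the torus. -/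
noncomputable def partialDeriv {d : ℕ} (i : Fin d) (f : Torus d → ℂ) (x : Torus d) : ℂ :=
  deriv (fun h : ℝ => f (x + Pi.single i (h : AddCircle (2 * π)))) 0

theorem hasDerivAt_comp_torusMk {d : ℕ} {f : Torus d → ℂ} (hf : SmoothFun f) (i : Fin d)
    (x : Fin d → ℝ) (h : ℝ) :
    HasDerivAt (fun h : ℝ => f (torusMk x + Pi.single i (h : AddCircle (2 * π))))
      (fderiv ℝ (f ∘ torusMk) (x + h • Pi.single i 1) (Pi.single i 1)) h := by
  simp only [torusMk_add_single]
  have h1 : HasFDerivAt (f ∘ torusMk) (fderiv ℝ (f ∘ torusMk) (x + h • Pi.single i 1))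
      (x + h • Pi.single i 1) :=
    ((ContDiff.differentiable hf (by simp)) _).hasFDerivAt
  have h2 : HasDerivAt (fun h : ℝ => x + h • (Pi.single i 1 : Fin d → ℝ))
      (Pi.single i 1) h := by
    simpa using ((hasDerivAt_id h).smul_const (Pi.single i 1 : Fin d → ℝ)).const_add x
  exact h1.comp_hasDerivAt h h2

theorem partialDeriv_torusMk {d : ℕ} {f : Torus d → ℂ} (hf : SmoothFun f) (i : Fin d)
    (x : Fin d → ℝ) :
    partialDeriv i f (torusMk x) = fderiv ℝ (f ∘ torusMk) x (Pi.single i 1) := by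
  simpa [partialDeriv] using (hasDerivAt_comp_torusMk hf i x 0).deriv

theorem SmoothFun.partialDeriv {d : ℕ} {f : Torus d → ℂ} (hf : SmoothFun f) (i : Fin d) :
    SmoothFun (partialDeriv i f) := by
  have : CGL.partialDeriv i f ∘ torusMk =
      fun x => fderiv ℝ (f ∘ torusMk) x (Pi.single i 1) :=
    funext fun x => partialDeriv_torusMk hf i x
  rw [SmoothFun, this]
  exact (ContDiff.fderiv_right (m := ∞) hf (by simp)).clm_apply contDiff_const

theorem SmoothFun.hasDerivAt {d : ℕ} {f : Torus d → ℂ} (hf : SmoothFun f) (i : Fin d)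
    (x : Torus d) (h : ℝ) :
    HasDerivAt (fun h : ℝ => f (x + Pi.single i (h : AddCircle (2 * π))))
      (CGL.partialDeriv i f (x + Pi.single i (h : AddCircle (2 * π)))) h := by
  obtain ⟨x, rfl⟩ := (isOpenQuotientMap_torusMk d).surjective x
  rw [torusMk_add_single, partialDeriv_torusMk hf]
  exact hasDerivAt_comp_torusMk hf i x h

theorem char_add_apply {d : ℕ} (k : Fin d → ℤ) (x y : Torus d) :
    char k (x + y) = char k x * char k y := by
  simp [char, Finset.prod_mul_distrib, AddCircle.toCircle_add]

theorem char_single_apply {d : ℕ} (k : Fin d → ℤ) (i : Fin d) (h : ℝ) :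
    char k (Pi.single i (h : AddCircle (2 * π))) = Complex.exp (Complex.I * k i * h) := by
  have : Pi.single i (h : AddCircle (2 * π)) =
      fun j => ((Pi.single i h : Fin d → ℝ) j : AddCircle (2 * π)) := by
    ext j
    by_cases hj : j = i
    · subst hj; simp
    · simp [hj]
  rw [this, char_coe, Finset.sum_eq_single i]
  · simp [mul_assoc]
  · intro j _ hj; simp [hj]
  · simp

theorem fourierCoef_translate {d : ℕ} (f : Torus d → ℂ) (a : Torus d) (k : Fin d → ℤ) :
    fourierCoef (fun x => f (x + a)) k = char k a * fourierCoef f k := by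
  have h := integral_add_right_eq_self (μ := torusMeasure d)
    (fun x => f x * char (-k) (x - a)) a
  simp only [add_sub_cancel_right] at h
  rw [fourierCoef, h, fourierCoef, ← integral_const_mul]
  refine integral_congr_ae (Eventually.of_forall fun x => ?_)
  have h0 : char k a * char (-k) a = 1 := by
    rw [← char_add, add_neg_cancel, char_zero]; rfl
  have h1 : char (-k) x = char (-k) (x - a) * char (-k) a := by
    rw [← char_add_apply, sub_add_cancel]
  simp only [h1]
  linear_combination (-f x * char (-k) (x - a)) * h0

/-- Differentiation under the integral; on the compact torus the continuous partial derivative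
supplies a constant dominating function. -/
theorem hasDerivAt_fourierCoef_translate {d : ℕ} {f : Torus d → ℂ} (hf : SmoothFun f)
    (i : Fin d) (k : Fin d → ℤ) :
    HasDerivAt (fun h : ℝ => fourierCoef
        (fun x => f (x + Pi.single i (h : AddCircle (2 * π)))) k)
      (fourierCoef (fun x => partialDeriv i f
        (x + Pi.single i ((0 : ℝ) : AddCircle (2 * π)))) k) 0 := by
  have hg := (hf.partialDeriv i).continuous
  obtain ⟨b, hb⟩ := isCompact_univ.exists_bound_of_continuousOn hg.continuousOn
  have hcont : ∀ (g : Torus d → ℂ) (_ : Continuous g) (h : ℝ),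
      Continuous fun x => g (x + Pi.single i (h : AddCircle (2 * π))) * char (-k) x :=
    fun g hg h => (hg.comp (continuous_id.add continuous_const)).mul (char (-k)).continuous
  let F : ℝ → Torus d → ℂ := fun h x =>
    f (x + Pi.single i (h : AddCircle (2 * π))) * char (-k) x
  let F' : ℝ → Torus d → ℂ := fun h x =>
    partialDeriv i f (x + Pi.single i (h : AddCircle (2 * π))) * char (-k) x
  have hF : ∀ h, Continuous (F h) := hcont f hf.continuous
  have hF' : ∀ h, Continuous (F' h) := hcont _ hg
  have hbd : ∀ x h, ‖F' h x‖ ≤ b := fun x h => by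
    rw [norm_mul, norm_char_apply, mul_one]
    exact hb _ (mem_univ _)
  have hder : ∀ x h, HasDerivAt (fun h => F h x) (F' h x) h := fun x h =>
    (hf.hasDerivAt i x h).mul_const _
  exact (hasDerivAt_integral_of_dominated_loc_of_deriv_le (F := F) (F' := F')
    (bound := fun _ => b) univ_mem
    (Eventually.of_forall fun h => (hF h).aestronglyMeasurable)
    (integrable_of_continuous (hF 0)) (hF' 0).aestronglyMeasurable
    (Eventually.of_forall fun x h _ => hbd x h) (integrable_const _)
    (Eventually.of_forall fun x h _ => hder x h)).2

/-- Translation by `h` in direction `i` multiplies the coefficient by `exp (i kᵢ h)`.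
Differentiating at `h = 0` in two ways and comparing takes the place of integration by parts. -/
theorem fourierCoef_partialDeriv {d : ℕ} {f : Torus d → ℂ} (hf : SmoothFun f) (i : Fin d)
    (k : Fin d → ℤ) :
    fourierCoef (partialDeriv i f) k = Complex.I * k i * fourierCoef f k := by
  have h1 := hasDerivAt_fourierCoef_translate hf i k
  simp only [fourierCoef_translate, char_single_apply] at h1
  have h3 : HasDerivAt (fun h : ℝ => Complex.exp (Complex.I * k i * h) * fourierCoef f k)
      (Complex.I * k i * fourierCoef f k) 0 := by
    have := (((Complex.ofRealCLM.hasDerivAt (x := 0)).const_mul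
      (Complex.I * (k i : ℂ))).cexp).mul_const (fourierCoef f k)
    simpa using this
  simpa using h1.unique h3

/-- The function is `(1 - Δ)ᵐ f`. Parseval for it yields polynomial decay of the coefficients of
`f`. -/
theorem exists_smooth_fourierCoef_eq {d : ℕ} {f : Torus d → ℂ} (hf : SmoothFun f) (m : ℕ) :
    ∃ g : Torus d → ℂ, SmoothFun g ∧
      ∀ k, fourierCoef g k = ((1 + sqNorm k : ℝ) : ℂ) ^ m * fourierCoef f k := by
  induction m with
  | zero => exact ⟨f, hf, fun k => by simp⟩
  | succ m ih =>
    obtain ⟨g, hg, hgk⟩ := ih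
    have hd : ∀ i, SmoothFun (partialDeriv i (partialDeriv i g)) := fun i =>
      (hg.partialDeriv i).partialDeriv i
    refine ⟨fun x => g x - ∑ i, partialDeriv i (partialDeriv i g) x, ?_, fun k => ?_⟩
    · exact ContDiff.sub hg (ContDiff.sum fun i _ => hd i)
    · have hi : ∀ {f : Torus d → ℂ} (_ : SmoothFun f),
          Integrable (fun x => f x * char (-k) x) (torusMeasure d) := fun hf =>
        integrable_of_continuous (hf.continuous.mul (char (-k)).continuous)
      have h1 : fourierCoef (fun x => g x - ∑ i, partialDeriv i (partialDeriv i g) x) k =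
          fourierCoef g k - ∑ i, fourierCoef (partialDeriv i (partialDeriv i g)) k := by
        simp only [fourierCoef, sub_mul, Finset.sum_mul]
        rw [integral_sub (hi hg) (integrable_finsetSum _ fun i _ => hi (hd i)),
          integral_finsetSum _ fun i _ => hi (hd i)]
      have h2 : ∀ i, fourierCoef (partialDeriv i (partialDeriv i g)) k =
          -((k i : ℂ) ^ 2) * fourierCoef g k := fun i => by
        rw [fourierCoef_partialDeriv (hg.partialDeriv i), fourierCoef_partialDeriv hg]
        linear_combination (k i : ℂ) ^ 2 * fourierCoef g k * Complex.I_sq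
      simp only [h1, h2]
      rw [← Finset.sum_mul, Finset.sum_neg_distrib, pow_succ, mul_comm (_ ^ m), mul_assoc, ← hgk]
      simp only [sqNorm]
      push_cast
      ring

namespace Sobolev

/-- Smooth functions belong to `Hˢ`. -/
theorem exists_ae_eq_of_smooth {d : ℕ} (s : ℝ) {f : Torus d → ℂ} (hf : SmoothFun f) :
    ∃ g : Sobolev d s, g =ᵐ[torusMeasure d] f := by
  have hmem : ∀ {f : Torus d → ℂ} (_ : SmoothFun f), MemLp f 2 (torusMeasure d) := fun hf =>
    hf.continuous.memLp_of_hasCompactSupport (HasCompactSupport.of_compactSpace _)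
  obtain ⟨m, hm⟩ := exists_nat_ge s
  obtain ⟨g, hg, hgk⟩ := exists_smooth_fourierCoef_eq hf m
  have h := lp.memℓp ((charBasis d).repr ((hmem hg).toLp g))
  rw [memℓp_gen_iff (by simp)] at h
  simp only [charBasis_repr, fourierCoef_congr_ae (hmem hg).coeFn_toLp, hgk,
    ENNReal.toReal_ofNat, Real.rpow_two] at h
  refine exists_ae_eq (hmem hf) (Summable.of_nonneg_of_le (fun k =>
    mul_nonneg (weight_pos s k).le (sq_nonneg _)) (fun k => ?_) h)
  rw [norm_mul, mul_pow]
  gcongr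
  have h1 : 1 ≤ 1 + sqNorm k := by linarith [sqNorm_nonneg k]
  rw [norm_pow, Complex.norm_real, Real.norm_eq_abs, abs_of_nonneg (by linarith), ← pow_mul,
    ← Real.rpow_natCast]
  refine Real.rpow_le_rpow_of_exponent_le h1 ?_
  push_cast
  have : (0 : ℝ) ≤ m := m.cast_nonneg
  linarith

theorem smoothFun_component {d q : ℕ} {Q : Torus d → EuclideanSpace ℝ (Fin q)}
    (hQ : SmoothField Q) (j : Fin q) : SmoothFun fun x => ((Q x j : ℝ) : ℂ) := by
  have h := contDiff_euclidean.1 (show ContDiff ℝ ∞ fun x => Q (torusMk x) from hQ) j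
  exact Complex.ofRealCLM.contDiff.comp h

/-- Multiplication by `c ⟨u, Q⟩` is a bounded operator on `Hˢ` depending linearly on `u`. -/
theorem exists_control_operator {d q : ℕ} {s : ℝ} (hs : (d : ℝ) / 2 < s)
    {Q : Torus d → EuclideanSpace ℝ (Fin q)} (hQ : SmoothField Q) (c : ℂ) :
    ∃ B : EuclideanSpace ℝ (Fin q) →L[ℝ] Sobolev d s →L[ℝ] Sobolev d s, ∀ u f,
      B u f =ᵐ[torusMeasure d] fun x => c * ((inner ℝ u (Q x) : ℝ) : ℂ) * f x := by
  choose g hg using fun j => exists_ae_eq_of_smooth s (smoothFun_component hQ j)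
  obtain ⟨C, hC, hmul⟩ := exists_mul (d := d) hs
  choose m hm hmn using hmul
  -- Since `⟨u, Q⟩ = ∑ uⱼ Qⱼ`, it suffices to multiply by the finitely many smooth components `Qⱼ`.
  let b : EuclideanSpace ℝ (Fin q) → Sobolev d s → Sobolev d s := fun u f =>
    ∑ j, (c * (u j : ℂ)) • m (g j) f
  have hb : ∀ u f, b u f =ᵐ[torusMeasure d]
      fun x => c * ((inner ℝ u (Q x) : ℝ) : ℂ) * f x := fun u f => by
    have h1 : ∀ S : Finset (Fin q),
        (∑ j ∈ S, (c * (u j : ℂ)) • m (g j) f : Sobolev d s) =ᵐ[torusMeasure d]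
          fun x => ∑ j ∈ S, c * (u j : ℂ) * ((Q x j : ℝ) : ℂ) * f x := fun S => by
      induction S using Finset.induction_on with
      | empty =>
        simp only [Finset.sum_empty, map_zero]
        exact Lp.coeFn_zero _ _ _
      | insert j S hj ih =>
        simp only [Finset.sum_insert hj]
        filter_upwards [coeFn_add ((c * (u j : ℂ)) • m (g j) f)
          (∑ j ∈ S, (c * (u j : ℂ)) • m (g j) f), ih, coeFn_smul (c * (u j : ℂ)) (m (g j) f),
          hm (g j) f, hg j] with x h1 h2 h3 h4 h5
        rw [h1, h2, h3, h4, h5]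
        ring
    refine (h1 Finset.univ).trans (Eventually.of_forall fun x => ?_)
    simp only [PiLp.inner_apply, RCLike.inner_apply, conj_trivial, Complex.ofReal_sum,
      Finset.mul_sum, Finset.sum_mul, Complex.ofReal_mul]
    exact Finset.sum_congr rfl fun j _ => by ring
  have hR : ∀ (r : ℝ) (f : Sobolev d s), (r • f : Sobolev d s) = (r : ℂ) • f := fun _ _ => rfl
  let l : EuclideanSpace ℝ (Fin q) →ₗ[ℝ] Sobolev d s →ₗ[ℝ] Sobolev d s :=
    LinearMap.mk₂ ℝ b
      (fun u v f => ext_ae (by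
        filter_upwards [hb (u + v) f, coeFn_add (b u f) (b v f), hb u f, hb v f]
          with x h1 h2 h3 h4
        rw [h1, h2, h3, h4, inner_add_left]
        push_cast; ring))
      (fun r u f => ext_ae (by
        rw [hR]
        filter_upwards [hb (r • u) f, coeFn_smul (r : ℂ) (b u f), hb u f] with x h1 h2 h3
        rw [h1, h2, h3, real_inner_smul_left]
        push_cast; ring))
      (fun u f h => ext_ae (by
        filter_upwards [hb u (f + h), coeFn_add (b u f) (b u h), hb u f, hb u h, coeFn_add f h]
          with x h1 h2 h3 h4 h5
        rw [h1, h2, h3, h4, h5]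
        ring))
      (fun r u f => ext_ae (by
        rw [hR, hR]
        filter_upwards [hb u ((r : ℂ) • f), coeFn_smul (r : ℂ) (b u f), hb u f,
          coeFn_smul (r : ℂ) f] with x h1 h2 h3 h4
        rw [h1, h2, h3, h4]
        ring))
  refine ⟨l.mkContinuous₂ (∑ j, ‖c‖ * (C * ‖g j‖)) fun u f => ?_, hb⟩
  change ‖∑ j, (c * (u j : ℂ)) • m (g j) f‖ ≤ _
  rw [Finset.sum_mul, Finset.sum_mul]
  refine norm_sum_le_of_le _ fun j _ => ?_
  rw [norm_smul, norm_mul, Complex.norm_real]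
  calc ‖c‖ * ‖u j‖ * ‖m (g j) f‖ ≤ ‖c‖ * ‖u‖ * (C * ‖g j‖ * ‖f‖) := by
        gcongr
        exacts [PiLp.norm_apply_le u j, hmn _ _]
    _ = _ := by ring

end Sobolev

/-! `L²` norms on `[0, T]`. -/

section NormL2

variable {E : Type*} [NormedAddCommGroup E]

theorem MemL2.mono {T T' : ℝ} {u : ℝ → E} (hu : MemL2 T u) (h : T' ≤ T) : MemL2 T' u :=
  MemLp.mono_measure (Measure.restrict_mono (Icc_subset_Icc_right h) le_rfl) hu

theorem MemL2.sub {T : ℝ} {u w : ℝ → E} (hu : MemL2 T u) (hw : MemL2 T w) : MemL2 T (u - w) :=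
  MemLp.sub hu hw

theorem normL2_nonneg (T : ℝ) (u : ℝ → E) : 0 ≤ normL2 T u := ENNReal.toReal_nonneg

theorem normL2_le_add {T : ℝ} {u w : ℝ → E} (hu : MemL2 T u) (hw : MemL2 T w) :
    normL2 T u ≤ normL2 T (u - w) + normL2 T w := by
  have h := eLpNorm_add_le (hu.sub hw).1 hw.1 (by norm_num : (1 : ℝ≥0∞) ≤ 2)
  rw [sub_add_cancel] at h
  rw [normL2, normL2, normL2, ← ENNReal.toReal_add (hu.sub hw).2.ne hw.2.ne]
  exact ENNReal.toReal_mono (ENNReal.add_ne_top.2 ⟨(hu.sub hw).2.ne, hw.2.ne⟩) h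

theorem MemL2.integrableOn_norm {T : ℝ} {u : ℝ → E} (hu : MemL2 T u) :
    IntegrableOn (fun τ => ‖u τ‖) (Icc 0 T) :=
  (MemLp.integrable (by norm_num) hu).norm

theorem MemL2.intervalIntegrable_norm_mul {T a b : ℝ} {u : ℝ → E} (hu : MemL2 T u)
    (ha : 0 ≤ a) (hab : a ≤ b) (hb : b ≤ T) {g : ℝ → ℝ} (hg : Continuous g) :
    IntervalIntegrable (fun τ => ‖u τ‖ * g τ) volume a b := by
  rw [intervalIntegrable_iff_integrableOn_Icc_of_le hab]
  exact (hu.integrableOn_norm.mono_set (Icc_subset_Icc ha hb)).mul_continuousOn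
    hg.continuousOn isCompact_Icc

theorem MemL2.integral_norm_mul_le {T a b : ℝ} {u : ℝ → E} (hu : MemL2 T u)
    (ha : 0 ≤ a) (hab : a ≤ b) (hb : b ≤ T) {g : ℝ → ℝ} (hg : Continuous g) (hg0 : ∀ τ, 0 ≤ g τ) :
    ∫ τ in a..b, ‖u τ‖ * g τ ≤ normL2 T u * √(∫ τ in a..b, g τ ^ 2) := by
  have hle : (volume.restrict (Ioc a b) : Measure ℝ) ≤ volume.restrict (Icc 0 T) :=
    Measure.restrict_mono
      (show Ioc a b ⊆ Icc 0 T from fun τ hτ => ⟨ha.trans hτ.1.le, hτ.2.trans hb⟩) le_rfl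
  have hu' : MemLp u 2 (volume.restrict (Ioc a b)) := MemLp.mono_measure hle hu
  have hg' : MemLp g 2 (volume.restrict (Ioc a b)) :=
    (memLp_two_iff_integrable_sq hg.aestronglyMeasurable).2 (hg.pow 2).integrableOn_Ioc
  rw [intervalIntegral.integral_of_le hab, intervalIntegral.integral_of_le hab]
  have h := integral_mul_le_Lp_mul_Lq_of_nonneg (μ := volume.restrict (Ioc a b))
    Real.HolderConjugate.two_two (f := fun τ => ‖u τ‖) (g := g)
    (Eventually.of_forall fun _ => norm_nonneg _) (Eventually.of_forall hg0)
    (by simpa using hu'.norm) (by simpa using hg')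
  simp only [Real.rpow_two, ← Real.sqrt_eq_rpow] at h
  refine h.trans (mul_le_mul_of_nonneg_right ?_ (Real.sqrt_nonneg _))
  have h2 : (eLpNorm u 2 (volume.restrict (Ioc a b))).toReal =
      √(∫ τ in Ioc a b, ‖u τ‖ ^ 2) := by
    rw [hu'.eLpNorm_eq_integral_rpow_norm (by norm_num) (by norm_num),
      ENNReal.toReal_ofReal (by positivity)]
    simp [Real.sqrt_eq_rpow]
  rw [← h2]
  exact ENNReal.toReal_mono hu.2.ne (eLpNorm_mono_measure u hle)

theorem MemL2.integral_norm_le {T a b : ℝ} {u : ℝ → E} (hu : MemL2 T u)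
    (ha : 0 ≤ a) (hab : a ≤ b) (hb : b ≤ T) :
    ∫ τ in a..b, ‖u τ‖ ≤ normL2 T u * √(b - a) := by
  simpa using hu.integral_norm_mul_le ha hab hb (continuous_const (y := (1 : ℝ)))
    fun _ => zero_le_one

theorem integral_exp_mul_le {l t : ℝ} (hl : 0 < l) :
    ∫ τ in (0 : ℝ)..t, Real.exp (l * τ) ≤ Real.exp (l * t) / l := by
  rw [intervalIntegral.integral_comp_mul_left (fun x => Real.exp x) hl.ne', integral_exp]
  simp only [mul_zero, Real.exp_zero, smul_eq_mul]
  rw [div_eq_inv_mul]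
  gcongr
  linarith

/-- An `L²` coefficient is absorbed by a large exponential weight. -/
theorem MemL2.integral_weight_le {T t K m l : ℝ} {u : ℝ → E} (hu : MemL2 T u) (hK : 0 ≤ K)
    (hm : 0 ≤ m) (hl : 1 ≤ l) (ht : 0 ≤ t) (htT : t ≤ T) :
    ∫ τ in (0 : ℝ)..t, (K + m * ‖u τ‖) * Real.exp (l * τ) ≤
      (K + m * normL2 T u) / √l * Real.exp (l * t) := by
  have hl0 : 0 < l := by linarith
  have hsq : 0 < √l := Real.sqrt_pos.2 hl0
  have hc : Continuous fun τ : ℝ => Real.exp (l * τ) := by fun_prop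
  have h1 := hu.intervalIntegrable_norm_mul le_rfl ht htT hc
  have h2 := hu.integral_norm_mul_le le_rfl ht htT hc fun _ => (Real.exp_pos _).le
  -- The gain `1/√l` for the `L²` coefficient; the constant part gains `1/l`, weakened below to
  -- `1/√l` using `l ≥ 1`.
  have h3 : √(∫ τ in (0 : ℝ)..t, Real.exp (l * τ) ^ 2) ≤ Real.exp (l * t) / √l := by
    refine Real.sqrt_le_iff.2 ⟨by positivity, ?_⟩
    have h4 := integral_exp_mul_le (l := 2 * l) (t := t) (by linarith)
    have h5 : ∀ τ, Real.exp (l * τ) ^ 2 = Real.exp (2 * l * τ) := fun τ => by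
      rw [← Real.exp_nat_mul]; congr 1; push_cast; ring
    rw [div_pow, Real.sq_sqrt hl0.le]
    simp only [h5]
    refine h4.trans ?_
    gcongr
    linarith
  have h4 : ∫ τ in (0 : ℝ)..t, Real.exp (l * τ) ≤ Real.exp (l * t) / √l := by
    refine (integral_exp_mul_le hl0).trans ?_
    gcongr
    rw [Real.sqrt_le_left (by linarith)]
    nlinarith
  calc _ = K * (∫ τ in (0 : ℝ)..t, Real.exp (l * τ)) +
        m * ∫ τ in (0 : ℝ)..t, ‖u τ‖ * Real.exp (l * τ) := by
        rw [← intervalIntegral.integral_const_mul, ← intervalIntegral.integral_const_mul,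
          ← intervalIntegral.integral_add ((hc.intervalIntegrable _ _).const_mul _)
            (h1.const_mul _)]
        congr 1
        ext τ
        ring
    _ ≤ K * (Real.exp (l * t) / √l) + m * (normL2 T u * (Real.exp (l * t) / √l)) := by
        gcongr
        exact h2.trans (mul_le_mul_of_nonneg_left h3 (normL2_nonneg _ _))
    _ = _ := by ring

end NormL2

/-! Radial retraction. -/

section Radial

variable {X : Type*} [NormedAddCommGroup X] [NormedSpace ℝ X]

/-- The radial retraction onto the closed ball of radius `R > 0`. -/
noncomputable def radial (R : ℝ) (x : X) : X := (R / max R ‖x‖) • x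

theorem radial_eq_self {R : ℝ} (hR : 0 < R) {x : X} (hx : ‖x‖ ≤ R) : radial R x = x := by
  rw [radial, max_eq_left hx, div_self hR.ne', one_smul]

theorem norm_radial_le {R : ℝ} (hR : 0 < R) (x : X) : ‖radial R x‖ ≤ R := by
  have h : 0 < max R ‖x‖ := hR.trans_le (le_max_left _ _)
  rw [radial, norm_smul, Real.norm_eq_abs, abs_of_pos (by positivity), div_mul_eq_mul_div,
    div_le_iff₀ h]
  gcongr
  exact le_max_right _ _

/-- The difference is one scaling applied to `x - y` plus a change of scaling at `y`. Each part is
at most `‖x - y‖`, the second because `max R ‖·‖` is 1-Lipschitz. -/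
theorem norm_radial_sub_le {R : ℝ} (hR : 0 < R) (x y : X) :
    ‖radial R x - radial R y‖ ≤ 2 * ‖x - y‖ := by
  have hx : 0 < max R ‖x‖ := hR.trans_le (le_max_left _ _)
  have hy : 0 < max R ‖y‖ := hR.trans_le (le_max_left _ _)
  have e : radial R x - radial R y =
      (R / max R ‖x‖) • (x - y) + (R / max R ‖x‖ - R / max R ‖y‖) • y := by
    simp only [radial, smul_sub, sub_smul]; abel
  have h1 : ‖(R / max R ‖x‖) • (x - y)‖ ≤ ‖x - y‖ := by
    rw [norm_smul, Real.norm_eq_abs, abs_of_pos (by positivity)]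
    exact mul_le_of_le_one_left (norm_nonneg _) ((div_le_one hx).2 (le_max_left _ _))
  have h2 : ‖(R / max R ‖x‖ - R / max R ‖y‖) • y‖ ≤ ‖x - y‖ := by
    have h3 : R / max R ‖x‖ - R / max R ‖y‖ =
        (R / max R ‖x‖) * ((max R ‖y‖ - max R ‖x‖) / max R ‖y‖) := by
      field_simp
    rw [norm_smul, h3, Real.norm_eq_abs, abs_mul,
      abs_of_pos (by positivity : 0 < R / max R ‖x‖), abs_div, abs_of_pos hy]
    have h4 : |max R ‖y‖ - max R ‖x‖| ≤ ‖x - y‖ := by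
      rw [norm_sub_rev]
      exact (by simpa only [max_comm R] using abs_max_sub_max_le_abs ‖y‖ ‖x‖ R :
        |max R ‖y‖ - max R ‖x‖| ≤ |‖y‖ - ‖x‖|).trans (abs_norm_sub_norm_le y x)
    have h5 : R / max R ‖x‖ ≤ 1 := (div_le_one hx).2 (le_max_left _ _)
    have h6 : ‖y‖ / max R ‖y‖ ≤ 1 := (div_le_one hy).2 (le_max_right _ _)
    calc _ = (R / max R ‖x‖) * (|max R ‖y‖ - max R ‖x‖| * (‖y‖ / max R ‖y‖)) := by ring
      _ ≤ 1 * (‖x - y‖ * 1) := by gcongr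
      _ = _ := by ring
  rw [e]
  linarith [norm_add_le ((R / max R ‖x‖) • (x - y)) ((R / max R ‖x‖ - R / max R ‖y‖) • y)]

end Radial

/-! ### Abstract semilinear problems and the Duhamel integral. -/

/-- The data of an abstract controlled semilinear evolution equation
`ψ' = Aψ + N(ψ) + B(u(t))ψ` on a Banach space `X`: a strongly continuous semigroup `S`, a continuous
nonlinearity `N` and a bilinear control term `B`. -/
structure SemilinearProblem (X E : Type*) [NormedAddCommGroup X] [NormedSpace ℝ X]
    [NormedAddCommGroup E] [NormedSpace ℝ E] where
  S : ℝ≥0 → X →L[ℝ] X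
  growth : ℝ
  growth_nonneg : 0 ≤ growth
  S_zero : ∀ x, S 0 x = x
  S_add : ∀ a b x, S (a + b) x = S a (S b x)
  norm_S_le : ∀ t x, ‖S t x‖ ≤ Real.exp (growth * t) * ‖x‖
  continuous_S : Continuous fun p : ℝ≥0 × X => S p.1 p.2
  N : X → X
  continuous_N : Continuous N
  B : E →L[ℝ] X →L[ℝ] X

namespace SemilinearProblem

variable {X E : Type*} [NormedAddCommGroup X] [NormedSpace ℝ X]
    [NormedAddCommGroup E] [NormedSpace ℝ E] (P : SemilinearProblem X E)

/-- The bound `exp (growth * T)` of the semigroup on `[0, T]`. -/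
noncomputable def amp (T : ℝ) : ℝ := Real.exp (P.growth * T)

theorem one_le_amp {T : ℝ} (hT : 0 ≤ T) : 1 ≤ P.amp T :=
  Real.one_le_exp (mul_nonneg P.growth_nonneg hT)

theorem norm_S_le_amp {T r : ℝ} (hT : 0 ≤ T) (hr : r ≤ T) (x : X) :
    ‖P.S r.toNNReal x‖ ≤ P.amp T * ‖x‖ := by
  refine (P.norm_S_le _ x).trans (mul_le_mul_of_nonneg_right ?_ (norm_nonneg _))
  refine Real.exp_le_exp.2 (mul_le_mul_of_nonneg_left ?_ P.growth_nonneg)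
  rw [Real.coe_toNNReal']
  exact max_le hr hT

/-- The right hand side `N(φ(τ)) + B(u(τ))φ(τ)`. -/
noncomputable def forcing (u : ℝ → E) (φ : ℝ → X) (τ : ℝ) : X := P.N (φ τ) + P.B (u τ) (φ τ)

/-- The Duhamel integral `∫₀ᵗ S(t - τ) G(τ) dτ`. -/
noncomputable def duhamel (G : ℝ → X) (t : ℝ) : X :=
  ∫ τ in (0 : ℝ)..t, P.S (t - τ).toNNReal (G τ)

/-- Mild solutions on `[0, T]`. -/
def IsSol (x : X) (u : ℝ → E) (T : ℝ) (φ : ℝ → X) : Prop :=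
  ContinuousOn φ (Icc 0 T) ∧
    ∀ t ∈ Icc 0 T, φ t = P.S t.toNNReal x + P.duhamel (P.forcing u φ) t

variable {P}

theorem continuous_S_sub_apply (x : X) (τ : ℝ) :
    Continuous fun t : ℝ => P.S (t - τ).toNNReal x :=
  P.continuous_S.comp (by fun_prop : Continuous fun t : ℝ => ((t - τ).toNNReal, x))

theorem aestronglyMeasurable_S_sub {G : ℝ → X} {μ : Measure ℝ} (hG : AEStronglyMeasurable G μ)
    (t : ℝ) : AEStronglyMeasurable (fun τ => P.S (t - τ).toNNReal (G τ)) μ :=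
  P.continuous_S.comp_aestronglyMeasurable
    ((by fun_prop : Continuous fun τ : ℝ => (t - τ).toNNReal).aestronglyMeasurable.prodMk hG)

theorem integrableOn_forcing {T : ℝ} {u : ℝ → E} {φ : ℝ → X} (hu : MemL2 T u)
    (hφ : ContinuousOn φ (Icc 0 T)) : IntegrableOn (P.forcing u φ) (Icc 0 T) := by
  have hN : ContinuousOn (fun τ => P.N (φ τ)) (Icc 0 T) := P.continuous_N.comp_continuousOn hφ
  refine hN.integrableOn_Icc.add ?_
  obtain ⟨b, hb⟩ := isCompact_Icc.exists_bound_of_continuousOn hφ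
  refine Integrable.mono' (g := fun τ => ‖P.B‖ * ‖u τ‖ * b) ?_ ?_ ?_
  · exact (hu.integrableOn_norm.const_mul _).mul_const _
  · exact P.B.aestronglyMeasurable_comp₂ hu.1
      (hφ.aestronglyMeasurable measurableSet_Icc)
  · refine (ae_restrict_mem measurableSet_Icc).mono fun τ hτ => ?_
    exact (P.B.le_opNorm₂ _ _).trans (mul_le_mul_of_nonneg_left (hb τ hτ) (by positivity))

theorem intervalIntegrable_S_sub {T a b t : ℝ} {G : ℝ → X} (hG : IntegrableOn G (Icc 0 T))
    (ha : 0 ≤ a) (hab : a ≤ b) (hb : b ≤ T) :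
    IntervalIntegrable (fun τ => P.S (t - τ).toNNReal (G τ)) volume a b := by
  rw [intervalIntegrable_iff_integrableOn_Icc_of_le hab]
  have hG' := hG.mono_set (Icc_subset_Icc ha hb)
  refine Integrable.mono' (hG'.norm.const_mul (P.amp (max t 0)))
    (aestronglyMeasurable_S_sub hG'.1 t) ?_
  refine (ae_restrict_mem measurableSet_Icc).mono fun τ hτ => ?_
  refine P.norm_S_le_amp (le_max_right _ _) ?_ _
  exact le_max_of_le_left (by linarith [hτ.1])

/-- The bound on `G` is not required at `b`, a null set. This matters in `IsSol.norm_lt`, where `b`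
is a first exit time. -/
theorem norm_integral_S_sub_le {T a b : ℝ} {G : ℝ → X} {g : ℝ → ℝ}
    (ha : 0 ≤ a) (hab : a ≤ b) (hb : b ≤ T) (hg : IntervalIntegrable g volume a b)
    (h : ∀ τ ∈ Ico a b, ‖G τ‖ ≤ g τ) :
    ‖∫ τ in a..b, P.S (b - τ).toNNReal (G τ)‖ ≤ P.amp T * ∫ τ in a..b, g τ := by
  rw [← intervalIntegral.integral_const_mul]
  refine intervalIntegral.norm_integral_le_of_norm_le hab ?_ (hg.const_mul _)
  refine (Measure.ae_ne volume b).mono fun τ hne hτ => ?_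
  refine (P.norm_S_le_amp (ha.trans (hab.trans hb)) (by linarith [hτ.1]) _).trans ?_
  exact mul_le_mul_of_nonneg_left (h τ ⟨hτ.1.le, hτ.2.lt_of_ne hne⟩) (Real.exp_pos _).le

/-- Dominated convergence, after an indicator moves the variable endpoint into the integrand. As a
function of `t`, the integrand is continuous at `t₀` for every `τ ≠ t₀`. -/
theorem continuousOn_duhamel {T : ℝ} {G : ℝ → X} (hG : IntegrableOn G (Icc 0 T)) :
    ContinuousOn (P.duhamel G) (Icc 0 T) := by
  have heq : ∀ t ∈ Icc 0 T, P.duhamel G t =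
      ∫ τ in Icc 0 T, (Iic t).indicator (fun τ => P.S (t - τ).toNNReal (G τ)) τ := by
    intro t ht
    rw [duhamel, intervalIntegral.integral_of_le ht.1, ← integral_Icc_eq_integral_Ioc,
      setIntegral_indicator measurableSet_Iic]
    congr 2
    ext τ
    exact ⟨fun h => ⟨⟨h.1, h.2.trans ht.2⟩, h.2⟩, fun h => ⟨h.1.1, h.2⟩⟩
  refine ContinuousOn.congr (fun t₀ ht₀ => ?_) heq
  refine continuousWithinAt_of_dominated (bound := fun τ => P.amp T * ‖G τ‖) ?_ ?_ ?_ ?_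
  · exact Eventually.of_forall fun t =>
      (aestronglyMeasurable_S_sub hG.1 t).indicator measurableSet_Iic
  · filter_upwards [self_mem_nhdsWithin] with t ht
    refine (ae_restrict_mem measurableSet_Icc).mono fun τ hτ => ?_
    refine (norm_indicator_le_norm_self _ _).trans ?_
    exact P.norm_S_le_amp (ht.1.trans ht.2) (by linarith [ht.2, hτ.1]) _
  · exact hG.norm.const_mul _
  · have hne : ∀ᵐ τ ∂(volume.restrict (Icc 0 T)), τ ≠ t₀ :=
      ae_restrict_of_ae (Measure.ae_ne volume t₀)
    filter_upwards [hne] with τ hτ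
    refine ContinuousAt.continuousWithinAt ?_
    rcases lt_or_gt_of_ne hτ with h | h
    · refine ((continuous_S_sub_apply (P := P) (G τ) τ).continuousAt (x := t₀)).congr ?_
      filter_upwards [lt_mem_nhds h] with t ht
      rw [indicator_of_mem (show τ ∈ Iic t from ht.le)]
    · refine (continuousAt_const (y := (0 : X))).congr ?_
      filter_upwards [gt_mem_nhds h] with t ht
      rw [indicator_of_notMem (fun h' : τ ∈ Iic t => absurd h' (not_le.2 ht))]

theorem continuous_S_toNNReal (x : X) : Continuous fun t : ℝ => P.S t.toNNReal x :=
  P.continuous_S.comp (by fun_prop : Continuous fun t : ℝ => (t.toNNReal, x))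

theorem duhamel_sub {T t : ℝ} {G H : ℝ → X} (hG : IntegrableOn G (Icc 0 T))
    (hH : IntegrableOn H (Icc 0 T)) (ht : t ∈ Icc 0 T) :
    P.duhamel G t - P.duhamel H t = P.duhamel (fun τ => G τ - H τ) t := by
  rw [duhamel, duhamel, duhamel, ← intervalIntegral.integral_sub
    (intervalIntegrable_S_sub hG le_rfl ht.1 ht.2) (intervalIntegrable_S_sub hH le_rfl ht.1 ht.2)]
  simp only [map_sub]

/-- Duhamel's formula restarted at time `a`. -/
theorem IsSol.restart {T a t : ℝ} {x : X} {u : ℝ → E} {φ : ℝ → X} [CompleteSpace X]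
    (h : P.IsSol x u T φ) (hu : MemL2 T u) (ha : 0 ≤ a) (hat : a ≤ t) (ht : t ≤ T) :
    φ t = P.S (t - a).toNNReal (φ a) +
      ∫ τ in a..t, P.S (t - τ).toNNReal (P.forcing u φ τ) := by
  have hG := integrableOn_forcing (P := P) hu h.1
  rw [h.2 t ⟨ha.trans hat, ht⟩, h.2 a ⟨ha, hat.trans ht⟩, map_add, ← P.S_add,
    ← Real.toNNReal_add (by linarith) ha, sub_add_cancel, add_assoc]
  congr 1
  rw [duhamel, duhamel, ← ContinuousLinearMap.intervalIntegral_comp_comm _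
    (intervalIntegrable_S_sub hG le_rfl ha (hat.trans ht)),
    ← intervalIntegral.integral_add_adjacent_intervals
      (intervalIntegrable_S_sub hG le_rfl ha (hat.trans ht))
      (intervalIntegrable_S_sub hG ha hat ht)]
  congr 1
  refine intervalIntegral.integral_congr fun τ hτ => ?_
  rw [uIcc_of_le ha] at hτ
  rw [← P.S_add, ← Real.toNNReal_add (by linarith) (by linarith [hτ.2]), sub_add_sub_cancel]

theorem IsSol.mono {T T' : ℝ} {x : X} {u : ℝ → E} {φ : ℝ → X} (h : P.IsSol x u T φ)
    (hT : T' ≤ T) : P.IsSol x u T' φ :=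
  ⟨h.1.mono (Icc_subset_Icc_right hT), fun t ht => h.2 t ⟨ht.1, ht.2.trans hT⟩⟩

theorem duhamel_congr {t : ℝ} (ht : 0 ≤ t) {G H : ℝ → X} (h : EqOn G H (Icc 0 t)) :
    P.duhamel G t = P.duhamel H t := by
  refine intervalIntegral.integral_congr fun τ hτ => ?_
  rw [uIcc_of_le ht] at hτ
  simp only [h hτ]

theorem IsSol.congr {T : ℝ} {x : X} {u : ℝ → E} {φ χ : ℝ → X} (h : P.IsSol x u T φ)
    (e : EqOn χ φ (Icc 0 T)) : P.IsSol x u T χ := by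
  refine ⟨h.1.congr e, fun t ht => ?_⟩
  rw [e ht, h.2 t ht]
  congr 1
  refine duhamel_congr ht.1 fun τ hτ => ?_
  simp only [forcing, e ⟨hτ.1, hτ.2.trans ht.2⟩]

/-! ### Exponentially weighted estimates and Lipschitz dependence. -/

/-- The exponential weight that makes the fixed point map a contraction. -/
noncomputable def rate (P : SemilinearProblem X E) (T K U : ℝ) : ℝ :=
  1 + (2 * (P.amp T * (K + ‖P.B‖ * U))) ^ 2

theorem one_le_rate (T K U : ℝ) : 1 ≤ P.rate T K U := le_add_of_nonneg_right (sq_nonneg _)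

/-- The basic weighted estimate of the Duhamel integral. -/
theorem norm_duhamel_le {F : Type*} [NormedAddCommGroup F] {T t K U D c : ℝ} {G : ℝ → X}
    {u : ℝ → E} {w : ℝ → F}
    (hu : MemL2 T u) (hw : MemL2 T w) (hK : 0 ≤ K) (hD : 0 ≤ D) (hc : 0 ≤ c)
    (hU : normL2 T u ≤ U) (ht : t ∈ Icc 0 T)
    (h : ∀ τ ∈ Icc 0 t, ‖G τ‖ ≤
      (K + ‖P.B‖ * ‖u τ‖) * (D * Real.exp (P.rate T K U * τ)) + c * ‖w τ‖) :
    ‖P.duhamel G t‖ ≤ 2⁻¹ * D * Real.exp (P.rate T K U * t) +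
      P.amp T * c * √T * normL2 T w := by
  set l := P.rate T K U with hl
  have hl1 : 1 ≤ l := one_le_rate _ _ _
  have hA : 0 < P.amp T := Real.exp_pos _
  have hexp : Continuous fun τ : ℝ => Real.exp (l * τ) := by fun_prop
  have hi1 : IntervalIntegrable (fun τ => (K + ‖P.B‖ * ‖u τ‖) * Real.exp (l * τ))
      volume 0 t := by
    have := ((hexp.intervalIntegrable 0 t).const_mul K).add
      ((hu.intervalIntegrable_norm_mul le_rfl ht.1 ht.2 hexp).const_mul ‖P.B‖)
    refine this.congr fun τ _ => ?_
    ring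
  have hi2 : IntervalIntegrable (fun τ => ‖w τ‖) volume 0 t := by
    simpa using hw.intervalIntegrable_norm_mul le_rfl ht.1 ht.2 (continuous_const (y := (1 : ℝ)))
  have h1 := norm_integral_S_sub_le (P := P) (T := T) le_rfl ht.1 ht.2
    ((hi1.const_mul D).add (hi2.const_mul c)) (G := G)
    (fun τ hτ => (h τ (Ico_subset_Icc_self hτ)).trans_eq (by ring))
  refine h1.trans ?_
  rw [intervalIntegral.integral_add (hi1.const_mul D) (hi2.const_mul c),
    intervalIntegral.integral_const_mul, intervalIntegral.integral_const_mul, mul_add]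
  have h2 := hu.integral_weight_le hK (norm_nonneg P.B) hl1 ht.1 ht.2
  have h3 := hw.integral_norm_le le_rfl ht.1 ht.2
  rw [sub_zero] at h3
  -- `rate` is chosen so that `√l` is at least twice `amp T * (K + ‖B‖ U)`.
  have h4 : P.amp T * ((K + ‖P.B‖ * normL2 T u) / √l) ≤ 2⁻¹ := by
    have hsq : 0 < √l := Real.sqrt_pos.2 (by linarith)
    have h5 : 2 * (P.amp T * (K + ‖P.B‖ * U)) ≤ √l :=
      Real.le_sqrt_of_sq_le (by rw [hl, rate]; linarith)
    rw [← mul_div_assoc, div_le_iff₀ hsq]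
    have h6 : P.amp T * (K + ‖P.B‖ * normL2 T u) ≤ P.amp T * (K + ‖P.B‖ * U) := by gcongr
    linarith
  refine add_le_add ?_ ?_
  · calc _ ≤ P.amp T * (D * ((K + ‖P.B‖ * normL2 T u) / √l * Real.exp (l * t))) := by gcongr
      _ = (P.amp T * ((K + ‖P.B‖ * normL2 T u) / √l)) * (D * Real.exp (l * t)) := by ring
      _ ≤ 2⁻¹ * (D * Real.exp (l * t)) := by gcongr
      _ = _ := by ring
  · calc _ ≤ P.amp T * (c * (normL2 T w * √T)) := by
          gcongr
          refine h3.trans (mul_le_mul_of_nonneg_left (Real.sqrt_le_sqrt ht.2) (normL2_nonneg _ _))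
      _ = _ := by ring

/-- The Lipschitz constant of the solution map. -/
noncomputable def lipConst (P : SemilinearProblem X E) (T K U R : ℝ) : ℝ :=
  2 * Real.exp (P.rate T K U * T) * (P.amp T * (1 + ‖P.B‖ * R * √T))

theorem lipConst_pos {T K U R : ℝ} (hR : 0 ≤ R) : 0 < P.lipConst T K U R := by
  have := Real.exp_pos (P.growth * T)
  unfold lipConst amp
  positivity

/-- With `D` the maximum of `exp (-lτ) ‖φ₁ - φ₂‖`, the Duhamel estimate at a maximising time bounds
`D` by `D/2` plus the data, which replaces Gronwall's lemma. Only `φ₂` needs a bound, since `B(u₁)φ₁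
- B(u₂)φ₂ = B(u₁)(φ₁ - φ₂) + B(u₁ - u₂)φ₂`. -/
theorem IsSol.norm_sub_le {T K U R : ℝ} {x₁ x₂ : X} {u₁ u₂ : ℝ → E} {φ₁ φ₂ : ℝ → X}
    (h₁ : P.IsSol x₁ u₁ T φ₁) (h₂ : P.IsSol x₂ u₂ T φ₂) (hu₁ : MemL2 T u₁) (hu₂ : MemL2 T u₂)
    (hK : 0 ≤ K) (hR : 0 ≤ R) (hN : ∀ x y, ‖P.N x - P.N y‖ ≤ K * ‖x - y‖)
    (hU : normL2 T u₁ ≤ U) (hφ₂ : ∀ t ∈ Icc 0 T, ‖φ₂ t‖ ≤ R) {t : ℝ} (ht : t ∈ Icc 0 T) :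
    ‖φ₁ t - φ₂ t‖ ≤ P.lipConst T K U R * (‖x₁ - x₂‖ + normL2 T (u₁ - u₂)) := by
  have hT : 0 ≤ T := ht.1.trans ht.2
  set l := P.rate T K U with hl
  have hl1 : 1 ≤ l := one_le_rate _ _ _
  have hcont : ContinuousOn (fun τ => Real.exp (-(l * τ)) * ‖φ₁ τ - φ₂ τ‖) (Icc 0 T) :=
    (by fun_prop : Continuous fun τ : ℝ => Real.exp (-(l * τ))).continuousOn.mul
      (h₁.1.sub h₂.1).norm
  obtain ⟨t₀, ht₀, hmax⟩ := isCompact_Icc.exists_isMaxOn (nonempty_Icc.2 hT) hcont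
  set D := Real.exp (-(l * t₀)) * ‖φ₁ t₀ - φ₂ t₀‖ with hD
  have hD0 : 0 ≤ D := by positivity
  have hle : ∀ τ ∈ Icc 0 T, ‖φ₁ τ - φ₂ τ‖ ≤ D * Real.exp (l * τ) := fun τ hτ => by
    have h := mul_le_mul_of_nonneg_right (hmax hτ) (Real.exp_pos (l * τ)).le
    simp only at h
    rwa [mul_right_comm, ← Real.exp_add, neg_add_cancel, Real.exp_zero, one_mul] at h
  have hest : ‖φ₁ t₀ - φ₂ t₀‖ ≤ P.amp T * ‖x₁ - x₂‖ + (2⁻¹ * D * Real.exp (l * t₀) +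
      P.amp T * (‖P.B‖ * R) * √T * normL2 T (u₁ - u₂)) := by
    have e : φ₁ t₀ - φ₂ t₀ = P.S t₀.toNNReal (x₁ - x₂) +
        P.duhamel (fun τ => P.forcing u₁ φ₁ τ - P.forcing u₂ φ₂ τ) t₀ := by
      rw [← duhamel_sub (integrableOn_forcing hu₁ h₁.1) (integrableOn_forcing hu₂ h₂.1) ht₀,
        h₁.2 t₀ ht₀, h₂.2 t₀ ht₀, map_sub]
      abel
    rw [e]
    refine (norm_add_le _ _).trans (add_le_add (P.norm_S_le_amp hT ht₀.2 _) ?_)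
    refine norm_duhamel_le hu₁ (hu₁.sub hu₂) hK hD0 (by positivity) hU ht₀ fun τ hτ => ?_
    have hτT : τ ∈ Icc 0 T := ⟨hτ.1, hτ.2.trans ht₀.2⟩
    have e2 : P.forcing u₁ φ₁ τ - P.forcing u₂ φ₂ τ = (P.N (φ₁ τ) - P.N (φ₂ τ)) +
        P.B (u₁ τ) (φ₁ τ - φ₂ τ) + P.B (u₁ τ - u₂ τ) (φ₂ τ) := by
      simp only [forcing, map_sub, _root_.sub_apply]
      abel
    rw [e2]
    refine norm_add₃_le.trans ?_
    have i1 := hN (φ₁ τ) (φ₂ τ)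
    have i2 := P.B.le_opNorm₂ (u₁ τ) (φ₁ τ - φ₂ τ)
    have i3 := P.B.le_opNorm₂ (u₁ τ - u₂ τ) (φ₂ τ)
    have i4 := hle τ hτT
    have i5 : ‖P.B‖ * ‖u₁ τ - u₂ τ‖ * ‖φ₂ τ‖ ≤ ‖P.B‖ * R * ‖(u₁ - u₂) τ‖ := by
      rw [mul_right_comm]
      simp only [Pi.sub_apply]
      gcongr
      exact hφ₂ τ hτT
    have i6 : (K + ‖P.B‖ * ‖u₁ τ‖) * ‖φ₁ τ - φ₂ τ‖ ≤
        (K + ‖P.B‖ * ‖u₁ τ‖) * (D * Real.exp (l * τ)) := by gcongr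
    linarith
  have hA := Real.exp_pos (P.growth * T)
  change 0 < P.amp T at hA
  have hn := normL2_nonneg T (u₁ - u₂)
  have hDle : D ≤ 2 * (P.amp T * ‖x₁ - x₂‖ +
      P.amp T * (‖P.B‖ * R) * √T * normL2 T (u₁ - u₂)) := by
    have hem : Real.exp (-(l * t₀)) ≤ 1 :=
      Real.exp_le_one_iff.2 (by have := mul_nonneg (zero_le_one.trans hl1) ht₀.1; linarith)
    have i1 := mul_le_mul_of_nonneg_left hest (Real.exp_pos (-(l * t₀))).le
    have i2 : Real.exp (-(l * t₀)) * (2⁻¹ * D * Real.exp (l * t₀)) = 2⁻¹ * D := by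
      rw [mul_comm, mul_assoc, ← Real.exp_add, add_neg_cancel, Real.exp_zero, mul_one]
    have i3 : Real.exp (-(l * t₀)) * (P.amp T * ‖x₁ - x₂‖ +
        P.amp T * (‖P.B‖ * R) * √T * normL2 T (u₁ - u₂)) ≤ P.amp T * ‖x₁ - x₂‖ +
        P.amp T * (‖P.B‖ * R) * √T * normL2 T (u₁ - u₂) :=
      mul_le_of_le_one_left (by positivity) hem
    rw [← hD] at i1
    linarith
  have hfin : P.amp T * ‖x₁ - x₂‖ + P.amp T * (‖P.B‖ * R) * √T * normL2 T (u₁ - u₂) ≤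
      P.amp T * (1 + ‖P.B‖ * R * √T) * (‖x₁ - x₂‖ + normL2 T (u₁ - u₂)) := by
    have i1 : 0 ≤ P.amp T * (‖P.B‖ * R * √T) * ‖x₁ - x₂‖ := by positivity
    have i2 : 0 ≤ P.amp T * normL2 T (u₁ - u₂) := by positivity
    linarith
  calc _ ≤ D * Real.exp (l * t) := hle t ht
    _ ≤ (2 * (P.amp T * (1 + ‖P.B‖ * R * √T) * (‖x₁ - x₂‖ + normL2 T (u₁ - u₂)))) *
        Real.exp (l * T) := by
      gcongr
      · linarith
      · exact ht.2
    _ = _ := by rw [lipConst]; ring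

end SemilinearProblem

theorem norm_le_normC {E : Type*} [NormedAddCommGroup E] {T : ℝ} {f : ℝ → E}
    (hf : ContinuousOn f (Icc 0 T)) {t : ℝ} (ht : t ∈ Icc 0 T) : ‖f t‖ ≤ normC T f :=
  le_csSup (isCompact_Icc.image_of_continuousOn hf.norm).bddAbove (mem_image_of_mem _ ht)

theorem normC_le {E : Type*} [NormedAddCommGroup E] {T c : ℝ} {f : ℝ → E} (hT : 0 ≤ T)
    (h : ∀ t ∈ Icc 0 T, ‖f t‖ ≤ c) : normC T f ≤ c := by
  refine csSup_le ((nonempty_Icc.2 hT).image _) ?_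
  rintro _ ⟨t, ht, rfl⟩
  exact h t ht

theorem exists_norm_bound {X : Type*} [NormedAddCommGroup X] {T : ℝ} {φ : ℝ → X}
    (hφ : ContinuousOn φ (Icc 0 T)) : ∃ R, 0 < R ∧ ∀ t ∈ Icc 0 T, ‖φ t‖ ≤ R := by
  obtain ⟨b, hb⟩ := isCompact_Icc.exists_bound_of_continuousOn hφ
  exact ⟨max b 1, by positivity, fun t ht => (hb t ht).trans (le_max_left _ _)⟩

/-! ### Existence, truncation, uniqueness and continuation. -/

namespace SemilinearProblem

variable {X E : Type*} [NormedAddCommGroup X] [NormedSpace ℝ X]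
    [NormedAddCommGroup E] [NormedSpace ℝ E] {P : SemilinearProblem X E}

/-- Global existence for a globally Lipschitz nonlinearity. -/
theorem exists_isSol_of_lipschitz [CompleteSpace X] {T K : ℝ} (hT : 0 ≤ T) (hK : 0 ≤ K)
    (hN : ∀ x y, ‖P.N x - P.N y‖ ≤ K * ‖x - y‖) (x : X) {u : ℝ → E} (hu : MemL2 T u) :
    ∃ φ, P.IsSol x u T φ := by
  set l := P.rate T K (normL2 T u) with hl
  -- The unknown is `f = exp (-lτ) φ`, so the plain sup norm of `f` is the weighted norm of `φ`.
  let e : C(Icc 0 T, X) → ℝ → X := fun f τ => Real.exp (l * τ) • IccExtend hT f τ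
  have he : ∀ f, Continuous (e f) := fun f =>
    (by fun_prop : Continuous fun τ : ℝ => Real.exp (l * τ)).smul f.continuous.Icc_extend'
  have hint : ∀ f, IntegrableOn (P.forcing u (e f)) (Icc 0 T) := fun f =>
    integrableOn_forcing hu (he f).continuousOn
  let y : C(Icc 0 T, X) → ℝ → X := fun f t =>
    Real.exp (-(l * t)) • (P.S t.toNNReal x + P.duhamel (P.forcing u (e f)) t)
  have hy : ∀ f, ContinuousOn (y f) (Icc 0 T) := fun f =>
    (by fun_prop : Continuous fun τ : ℝ => Real.exp (-(l * τ))).continuousOn.smul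
      ((continuous_S_toNNReal x).continuousOn.add (continuousOn_duhamel (hint f)))
  let Γ : C(Icc 0 T, X) → C(Icc 0 T, X) := fun f =>
    ⟨fun t => y f t, continuousOn_iff_continuous_domRestrict.1 (hy f)⟩
  have hcontr : ContractingWith (2⁻¹ : ℝ≥0) Γ := by
    refine ⟨by rw [← NNReal.coe_lt_coe]; norm_num, LipschitzWith.of_dist_le_mul fun f g => ?_⟩
    refine (ContinuousMap.dist_le (by positivity)).2 fun t => ?_
    have e1 : Γ f t - Γ g t = Real.exp (-(l * t)) •
        P.duhamel (fun τ => P.forcing u (e f) τ - P.forcing u (e g) τ) t := by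
      change y f t - y g t = _
      simp only [y]
      rw [← duhamel_sub (hint f) (hint g) t.2, ← smul_sub, add_sub_add_left_eq_sub]
    -- The control is the same for `f` and `g`, so the inhomogeneous term has `c = 0` and `w` is
    -- arbitrary.
    have h1 := norm_duhamel_le (P := P) (w := u) (D := dist f g) (c := 0)
      (G := fun τ => P.forcing u (e f) τ - P.forcing u (e g) τ) hu hu hK dist_nonneg le_rfl
      le_rfl t.2 (fun τ hτ => by
        have e2 : P.forcing u (e f) τ - P.forcing u (e g) τ =
            (P.N (e f τ) - P.N (e g τ)) + P.B (u τ) (e f τ - e g τ) := by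
          simp only [forcing, map_sub]; abel
        have e3 : ‖e f τ - e g τ‖ ≤ dist f g * Real.exp (l * τ) := by
          simp only [e]
          rw [← smul_sub, norm_smul, Real.norm_eq_abs, Real.abs_exp, mul_comm, ← dist_eq_norm]
          gcongr
          exact ContinuousMap.dist_apply_le_dist _
        rw [e2, zero_mul, add_zero]
        calc _ ≤ K * ‖e f τ - e g τ‖ + ‖P.B‖ * ‖u τ‖ * ‖e f τ - e g τ‖ :=
              (norm_add_le _ _).trans (add_le_add (hN _ _) (P.B.le_opNorm₂ _ _))
          _ = (K + ‖P.B‖ * ‖u τ‖) * ‖e f τ - e g τ‖ := by ring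
          _ ≤ _ := by gcongr)
    rw [dist_eq_norm, e1, norm_smul, Real.norm_eq_abs, Real.abs_exp]
    rw [mul_zero, zero_mul, zero_mul, add_zero, ← hl] at h1
    refine (mul_le_mul_of_nonneg_left h1 (Real.exp_pos _).le).trans_eq ?_
    rw [mul_comm, mul_assoc, ← Real.exp_add, add_neg_cancel, Real.exp_zero, mul_one]
    simp
  set f := hcontr.fixedPoint
  have hf : Γ f = f := hcontr.fixedPoint_isFixedPt
  refine ⟨e f, (he f).continuousOn, fun t ht => ?_⟩
  have h1 : y f t = f ⟨t, ht⟩ := congrArg (fun g : C(Icc 0 T, X) => g ⟨t, ht⟩) hf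
  change Real.exp (l * t) • IccExtend hT f t = _
  rw [IccExtend_of_mem _ _ ht, ← h1]
  simp only [y]
  rw [smul_smul, ← Real.exp_add, add_neg_cancel, Real.exp_zero, one_smul]

/-- The nonlinearity is Lipschitz on bounded sets. -/
def LocLip (P : SemilinearProblem X E) : Prop :=
  ∀ R : ℝ, ∃ L : ℝ, 0 ≤ L ∧ ∀ x y, ‖x‖ ≤ R → ‖y‖ ≤ R → ‖P.N x - P.N y‖ ≤ L * ‖x - y‖

/-- The problem with the nonlinearity made constant along rays outside the ball of radius `R`. -/
noncomputable def trunc (P : SemilinearProblem X E) (R : ℝ) (hR : 0 < R) :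
    SemilinearProblem X E :=
  { P with
    N := fun x => P.N (radial R x)
    continuous_N := P.continuous_N.comp
      (LipschitzWith.of_dist_le_mul (K := 2) fun x y => by
        simpa [dist_eq_norm] using norm_radial_sub_le hR x y).continuous }

theorem trunc_lipschitz {R L : ℝ} (hR : 0 < R) (hL : 0 ≤ L)
    (h : ∀ x y, ‖x‖ ≤ R → ‖y‖ ≤ R → ‖P.N x - P.N y‖ ≤ L * ‖x - y‖) (x y : X) :
    ‖(P.trunc R hR).N x - (P.trunc R hR).N y‖ ≤ L * 2 * ‖x - y‖ := by
  refine (h _ _ (norm_radial_le hR x) (norm_radial_le hR y)).trans ?_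
  rw [mul_assoc]
  exact mul_le_mul_of_nonneg_left (norm_radial_sub_le hR x y) hL

/-- The retraction is the identity on the ball, so both forcings agree along `φ`. This transfers
results from globally Lipschitz `N` to locally Lipschitz `N`. -/
theorem isSol_trunc_iff {R T : ℝ} (hR : 0 < R) {x : X} {u : ℝ → E} {φ : ℝ → X}
    (h : ∀ t ∈ Icc 0 T, ‖φ t‖ ≤ R) : (P.trunc R hR).IsSol x u T φ ↔ P.IsSol x u T φ := by
  have key : ∀ t ∈ Icc 0 T, (P.trunc R hR).duhamel ((P.trunc R hR).forcing u φ) t =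
      P.duhamel (P.forcing u φ) t := fun t ht => by
    refine duhamel_congr (P := P) ht.1 fun τ hτ => ?_
    change P.N (radial R (φ τ)) + _ = P.N (φ τ) + _
    rw [radial_eq_self hR (h τ ⟨hτ.1, hτ.2.trans ht.2⟩)]
    rfl
  refine and_congr Iff.rfl (forall₂_congr fun t ht => ?_)
  rw [key t ht]
  rfl

theorem IsSol.eqOn_of_lipschitz {T K : ℝ} {x : X} {u : ℝ → E} {φ χ : ℝ → X} (hK : 0 ≤ K)
    (hN : ∀ x y, ‖P.N x - P.N y‖ ≤ K * ‖x - y‖) (hu : MemL2 T u) (h : P.IsSol x u T φ)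
    (h' : P.IsSol x u T χ) : EqOn φ χ (Icc 0 T) := fun t ht => by
  obtain ⟨R, hR, hb⟩ := exists_norm_bound h'.1
  have := h.norm_sub_le h' hu hu hK hR.le hN le_rfl hb ht
  simpa [normL2, sub_eq_zero] using this

/-- Uniqueness of mild solutions. -/
theorem IsSol.eqOn (hP : P.LocLip) {T : ℝ} {x : X} {u : ℝ → E} {φ χ : ℝ → X}
    (hu : MemL2 T u) (h : P.IsSol x u T φ) (h' : P.IsSol x u T χ) : EqOn φ χ (Icc 0 T) := by
  obtain ⟨R₁, hR₁, hb₁⟩ := exists_norm_bound h.1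
  obtain ⟨R₂, -, hb₂⟩ := exists_norm_bound h'.1
  have hR : 0 < max R₁ R₂ := lt_max_of_lt_left hR₁
  obtain ⟨L, hL, hLip⟩ := hP (max R₁ R₂)
  exact IsSol.eqOn_of_lipschitz (P := P.trunc _ hR) (by positivity) (trunc_lipschitz hR hL hLip) hu
    ((isSol_trunc_iff hR fun t ht => (hb₁ t ht).trans (le_max_left _ _)).2 h)
    ((isSol_trunc_iff hR fun t ht => (hb₂ t ht).trans (le_max_right _ _)).2 h')

theorem isSol_zero (x : X) (u : ℝ → E) : P.IsSol x u 0 fun _ => x := by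
  refine ⟨continuousOn_const, fun t ht => ?_⟩
  obtain rfl : t = 0 := le_antisymm ht.2 ht.1
  simp [duhamel, P.S_zero]

/-- Solutions extend beyond every time up to which they exist. -/
theorem IsSol.exists_gt [CompleteSpace X] (hP : P.LocLip) {T : ℝ} (hT : 0 ≤ T) {x : X}
    {u : ℝ → E} {φ : ℝ → X} (hu : ∀ T, MemL2 T u) (h : P.IsSol x u T φ) :
    ∃ T' > T, ∃ χ, P.IsSol x u T' χ := by
  obtain ⟨R, hR, hb⟩ := exists_norm_bound h.1
  have hR1 : 0 < R + 1 := by linarith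
  obtain ⟨L, hL, hLip⟩ := hP (R + 1)
  have hlip := trunc_lipschitz hR1 hL hLip
  obtain ⟨χ, hχ⟩ := exists_isSol_of_lipschitz (P := P.trunc _ hR1) (T := T + 1) (by linarith)
    (by positivity : 0 ≤ L * 2) hlip x (hu _)
  have heq := IsSol.eqOn_of_lipschitz (by positivity : 0 ≤ L * 2) hlip (hu T)
    (hχ.mono (by linarith))
    ((isSol_trunc_iff hR1 fun t ht => (hb t ht).trans (by linarith)).2 h)
  have hχb : ∀ t ∈ Icc 0 T, ‖χ t‖ ≤ R := fun t ht => by rw [heq ht]; exact hb t ht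
  -- The truncated solution `χ` equals `φ` on `[0, T]`, so its norm at `T` is at most `R`; by
  -- continuity the truncation stays inactive a little longer.
  have hev : ∀ᶠ t in 𝓝[Icc 0 (T + 1)] T, ‖χ t‖ < R + 1 :=
    (hχ.1 T ⟨hT, by linarith⟩).norm.eventually_lt continuousWithinAt_const
      (by linarith [hχb T ⟨hT, le_rfl⟩])
  obtain ⟨ε, hε, hsub⟩ := Metric.mem_nhdsWithin_iff.1 hev
  have hm : 0 < min 1 (ε / 2) := by positivity
  refine ⟨T + min 1 (ε / 2), by linarith, χ, ?_⟩
  refine (isSol_trunc_iff hR1 fun t ht => ?_).1 (hχ.mono (by linarith [min_le_left 1 (ε / 2)]))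
  rcases le_or_gt t T with htT | htT
  · linarith [hχb t ⟨ht.1, htT⟩]
  · refine le_of_lt (hsub ⟨?_, ht.1, by linarith [min_le_left 1 (ε / 2), ht.2]⟩)
    rw [Metric.mem_ball, Real.dist_eq, abs_of_pos (by linarith)]
    linarith [min_le_right 1 (ε / 2), ht.2]

/-- A bounded solution on `[0, b)` extends to `[0, b]`. -/
theorem exists_isSol_of_bounded [CompleteSpace X] (hP : P.LocLip) {b R : ℝ} (hb : 0 < b)
    {x : X} {u : ℝ → E} {ψ : ℝ → X} (hu : MemL2 b u) (h : ∀ T, 0 ≤ T → T < b → P.IsSol x u T ψ)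
    (hR : ∀ t ∈ Ico 0 b, ‖ψ t‖ ≤ R) : ∃ χ, P.IsSol x u b χ := by
  have hR1 : 0 < max R 1 := by positivity
  obtain ⟨L, hL, hLip⟩ := hP (max R 1)
  have hlip := trunc_lipschitz hR1 hL hLip
  obtain ⟨χ, hχ⟩ := exists_isSol_of_lipschitz (P := P.trunc _ hR1) hb.le
    (by positivity : 0 ≤ L * 2) hlip x hu
  -- The truncated solution lives on the closed interval and coincides with `ψ` before `b`; its
  -- bound at `b` then follows by a limit.
  have heq : ∀ t ∈ Ico 0 b, χ t = ψ t := fun t ht =>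
    IsSol.eqOn_of_lipschitz (by positivity : 0 ≤ L * 2) hlip (hu.mono ht.2.le)
      (hχ.mono ht.2.le) ((isSol_trunc_iff hR1 fun τ hτ =>
        (hR τ ⟨hτ.1, hτ.2.trans_lt ht.2⟩).trans (le_max_left _ _)).2 (h t ht.1 ht.2))
      ⟨ht.1, le_rfl⟩
  have hlt : ∀ t ∈ Ico 0 b, ‖χ t‖ ≤ R := fun t ht => by rw [heq t ht]; exact hR t ht
  have hend : ‖χ b‖ ≤ R := by
    have : (𝓝[Ico 0 b] b).NeBot := by
      rw [← mem_closure_iff_nhdsWithin_neBot, closure_Ico hb.ne]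
      exact ⟨hb.le, le_rfl⟩
    exact le_of_tendsto ((hχ.1 b ⟨hb.le, le_rfl⟩).mono Ico_subset_Icc_self).norm
      (eventually_of_mem self_mem_nhdsWithin hlt)
  refine ⟨χ, (isSol_trunc_iff hR1 fun t ht => le_trans ?_ (le_max_left _ _)).1 hχ⟩
  rcases ht.2.lt_or_eq with h1 | rfl
  exacts [hlt t ⟨ht.1, h1⟩, hend]

/-! ### Blow-up and the maximal solution. -/

/-- A priori bound after restarting the equation. -/
theorem IsSol.norm_lt [CompleteSpace X] {a b t κ M R : ℝ} {x : X} {u : ℝ → E} {ψ : ℝ → X}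
    (h : P.IsSol x u t ψ) (hu : MemL2 b u) (ha : 0 ≤ a) (hat : a ≤ t) (htb : t ≤ b)
    (hM : ‖ψ a‖ ≤ M) (hκ : ∀ x, ‖x‖ ≤ R → ‖P.N x‖ ≤ κ) (hR : R = P.amp b * M + 1)
    (hsmall : P.amp b * (κ * (b - a) + ‖P.B‖ * R * (normL2 b u * √(b - a))) < 1) :
    ‖ψ t‖ < R := by
  have hb : 0 ≤ b := ha.trans (hat.trans htb)
  have hA : 1 ≤ P.amp b := P.one_le_amp hb
  have hM0 : 0 ≤ M := (norm_nonneg _).trans hM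
  have hMA : M ≤ P.amp b * M := le_mul_of_one_le_left hM0 hA
  have hR0 : 0 ≤ R := by linarith
  have hκ0 : 0 ≤ κ := (norm_nonneg _).trans (hκ 0 (by simpa using hR0))
  by_contra! hcon
  have hclosed : IsCompact (Icc a t ∩ (fun τ => ‖ψ τ‖) ⁻¹' Ici R) :=
    isCompact_Icc.of_isClosed_subset
      ((h.1.mono (Icc_subset_Icc_left ha)).norm.preimage_isClosed_of_isClosed isClosed_Icc
        isClosed_Ici) inter_subset_left
  -- At the first time `c` when the norm reaches `R`, the restarted Duhamel formula gives a norm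
  -- below `amp b * M + 1 = R`, a contradiction.
  obtain ⟨c, ⟨hc, hcR⟩, hleast⟩ := hclosed.exists_isLeast ⟨t, ⟨hat, le_rfl⟩, hcon⟩
  have hlt : ∀ τ ∈ Ico a c, ‖ψ τ‖ ≤ R := fun τ hτ => by
    by_contra! hτR
    exact absurd (hleast ⟨⟨hτ.1, hτ.2.le.trans hc.2⟩, hτR.le⟩) (not_le.2 hτ.2)
  have hcb : c ≤ b := hc.2.trans htb
  have hi : IntervalIntegrable (fun τ => ‖u τ‖) volume a c := by
    simpa using hu.intervalIntegrable_norm_mul ha hc.1 hcb (continuous_const (y := (1 : ℝ)))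
  have hle := norm_integral_S_sub_le (P := P) (G := P.forcing u ψ)
    (g := fun τ => κ + ‖P.B‖ * R * ‖u τ‖) ha hc.1 hcb
    (intervalIntegrable_const.add (hi.const_mul _)) (fun τ hτ => by
      refine (norm_add_le _ _).trans (add_le_add (hκ _ (hlt τ hτ)) ?_)
      refine (P.B.le_opNorm₂ _ _).trans ?_
      rw [mul_right_comm]
      gcongr
      exact hlt τ hτ)
  rw [intervalIntegral.integral_add intervalIntegrable_const (hi.const_mul _),
    intervalIntegral.integral_const, intervalIntegral.integral_const_mul, smul_eq_mul] at hle
  have hint : ∫ τ in a..c, ‖u τ‖ ≤ normL2 b u * √(b - a) :=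
    (hu.integral_norm_le ha hc.1 hcb).trans (mul_le_mul_of_nonneg_left
      (Real.sqrt_le_sqrt (by linarith)) (normL2_nonneg _ _))
  have hle2 : P.amp b * ((c - a) * κ + ‖P.B‖ * R * ∫ τ in a..c, ‖u τ‖) ≤
      P.amp b * (κ * (b - a) + ‖P.B‖ * R * (normL2 b u * √(b - a))) := by
    rw [mul_comm (c - a)]
    gcongr
  have h1 := h.restart (hu.mono htb) ha hc.1 hc.2
  have h2 : ‖ψ c‖ ≤ P.amp b * ‖ψ a‖ + ‖∫ τ in a..c, P.S (c - τ).toNNReal (P.forcing u ψ τ)‖ := by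
    rw [h1]
    exact (norm_add_le _ _).trans (add_le_add (P.norm_S_le_amp hb (by linarith) _) le_rfl)
  have h3 : P.amp b * ‖ψ a‖ ≤ P.amp b * M := by gcongr
  have h4 : R ≤ ‖ψ c‖ := hcR
  linarith

theorem LocLip.exists_norm_le (hP : P.LocLip) (R : ℝ) : ∃ κ, ∀ x, ‖x‖ ≤ R → ‖P.N x‖ ≤ κ := by
  obtain ⟨L, hL, h⟩ := hP R
  refine ⟨L * R + ‖P.N 0‖, fun x hx => ?_⟩
  have h1 := h x 0 hx (by simpa using (norm_nonneg x).trans hx)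
  rw [sub_zero] at h1
  have h2 : L * ‖x‖ ≤ L * R := by gcongr
  linarith [norm_le_norm_sub_add (P.N x) (P.N 0)]

/-- Blow-up alternative: if the solution does not extend to `[0, b]`, then its norm tends to
infinity at `b`. -/
theorem tendsto_norm_atTop [CompleteSpace X] (hP : P.LocLip) {b : ℝ} (hb : 0 < b)
    {x : X} {u : ℝ → E} {ψ : ℝ → X} (hu : MemL2 b u) (h : ∀ T, 0 ≤ T → T < b → P.IsSol x u T ψ)
    (hno : ¬ ∃ χ, P.IsSol x u b χ) : Tendsto (fun t => ‖ψ t‖) (𝓝[<] b) atTop := by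
  refine tendsto_atTop.2 fun M => ?_
  by_contra hM
  rw [not_eventually] at hM
  obtain ⟨κ, hκ⟩ := hP.exists_norm_le (P.amp b * M + 1)
  have hlim : Tendsto (fun a => P.amp b * (κ * (b - a) + ‖P.B‖ * (P.amp b * M + 1) *
      (normL2 b u * √(b - a)))) (𝓝[<] b) (𝓝 0) := by
    have hc : Continuous fun a => P.amp b * (κ * (b - a) + ‖P.B‖ * (P.amp b * M + 1) *
      (normL2 b u * √(b - a))) := by fun_prop
    simpa using (hc.tendsto b).mono_left nhdsWithin_le_nhds
  have hpos : ∀ᶠ a in 𝓝[<] b, a ∈ Ioo 0 b := Ioo_mem_nhdsLT hb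
  -- The norm is below `M` at times arbitrarily close to `b`; one is taken so late that the
  -- increment over `[a, b)` is less than `1`.
  obtain ⟨a, haM, hsmall, ha⟩ :=
    (hM.and_eventually ((hlim.eventually_lt_const one_pos).and hpos)).exists
  rw [not_le] at haM
  have hbd : ∀ t ∈ Ico a b, ‖ψ t‖ < P.amp b * M + 1 := fun t ht =>
    (h t (ha.1.le.trans ht.1) ht.2).norm_lt hu ha.1.le ht.1 ht.2.le haM.le hκ rfl hsmall
  obtain ⟨R, -, hR⟩ := exists_norm_bound (h a ha.1.le ha.2).1
  refine hno (exists_isSol_of_bounded hP hb hu h (R := max R (P.amp b * M + 1)) fun t ht => ?_)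
  rcases le_or_gt t a with hta | hta
  · exact (hR t ⟨ht.1, hta⟩).trans (le_max_left _ _)
  · exact (hbd t ⟨hta.le, ht.2⟩).le.trans (le_max_right _ _)

/-- The maximal solution. -/
theorem exists_maximal [CompleteSpace X] (hP : P.LocLip) (x : X) {u : ℝ → E}
    (hu : ∀ T, MemL2 T u) :
    ∃ (Tmax : EReal) (ψ : ℝ → X), 0 < Tmax ∧
      (∀ T : ℝ, 0 ≤ T → (T : EReal) < Tmax → P.IsSol x u T ψ) ∧
      (∀ T : ℝ, Tmax ≤ T → ¬ ∃ φ, P.IsSol x u T φ) ∧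
      (Tmax < ⊤ → Tendsto (fun t => ‖ψ t‖) (𝓝[<] Tmax.toReal) atTop) := by
  classical
  let s : Set ℝ := {T | 0 ≤ T ∧ ∃ φ, P.IsSol x u T φ}
  -- The value at `t` is read off a chosen solution on `[0, t]`; uniqueness makes these values fit
  -- together.
  let ψ : ℝ → X := fun t => if h : ∃ φ, P.IsSol x u t φ then h.choose t else 0
  have hψ : ∀ T ∈ s, P.IsSol x u T ψ := by
    rintro T ⟨-, φ, hφ⟩
    refine hφ.congr fun t ht => ?_
    have hex : ∃ φ, P.IsSol x u t φ := ⟨φ, hφ.mono ht.2⟩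
    simp only [ψ, dif_pos hex]
    exact IsSol.eqOn hP (hu t) hex.choose_spec (hφ.mono ht.2) ⟨ht.1, le_rfl⟩
  have hgt : ∀ T ∈ s, ∃ T' ∈ s, T < T' := by
    rintro T ⟨hT, φ, hφ⟩
    obtain ⟨T', hT', χ, hχ⟩ := hφ.exists_gt hP hT hu
    exact ⟨T', ⟨hT.trans hT'.le, χ, hχ⟩, hT'⟩
  have h0 : (0 : ℝ) ∈ s := ⟨le_rfl, _, isSol_zero x u⟩
  -- By `hgt` the set `s` has no greatest element, so the supremum is not attained.
  let Tmax : EReal := sSup ((fun T : ℝ => (T : EReal)) '' s)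
  have hlt : ∀ T ∈ s, (T : EReal) < Tmax := fun T hT => by
    obtain ⟨T', hT', h⟩ := hgt T hT
    exact (EReal.coe_lt_coe_iff.2 h).trans_le (le_sSup (mem_image_of_mem _ hT'))
  have hpos : 0 < Tmax := hlt 0 h0
  have hsol : ∀ T : ℝ, 0 ≤ T → (T : EReal) < Tmax → P.IsSol x u T ψ := fun T _ hT => by
    obtain ⟨_, ⟨T', hT', rfl⟩, h⟩ := lt_sSup_iff.1 hT
    exact (hψ T' hT').mono (EReal.coe_lt_coe_iff.1 h).le
  have hno : ∀ T : ℝ, Tmax ≤ T → ¬ ∃ φ, P.IsSol x u T φ := fun T hT hex => by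
    have hT0 : 0 ≤ T := (EReal.coe_lt_coe_iff.1 (hpos.trans_le hT)).le
    exact absurd (hlt T ⟨hT0, hex⟩) (not_lt.2 hT)
  refine ⟨Tmax, ψ, hpos, hsol, hno, fun htop => ?_⟩
  have hb : ((Tmax.toReal : ℝ) : EReal) = Tmax :=
    EReal.coe_toReal htop.ne (bot_lt_iff_ne_bot.1 (bot_le.trans_lt hpos))
  refine tendsto_norm_atTop hP (x := x) (u := u) ?_ (hu _) (fun T hT h => hsol T hT ?_) (hno _ hb.ge)
  · rw [← EReal.coe_lt_coe_iff, hb]; exact hpos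
  · rw [← hb]; exact EReal.coe_lt_coe_iff.2 h

/-! ### Stability. -/

/-- Stability and Lipschitz dependence of solutions on the initial state and the control, with
constants depending only on the time and the size of the reference solution and control. -/
theorem exists_stability [CompleteSpace X] (hP : P.LocLip) :
    ∃ δ C : ℝ → ℝ → ℝ, (∀ T Λ, 0 < δ T Λ ∧ 0 < C T Λ) ∧
      ∀ (x' : X) (u' : ℝ → E) (T : ℝ) (ψ' : ℝ → X), 0 ≤ T → MemL2 T u' → P.IsSol x' u' T ψ' →
        ∀ Λ : ℝ, Λ = normC T ψ' + normL2 T u' →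
          (∀ (x : X) (u : ℝ → E), MemL2 T u → ‖x - x'‖ + normL2 T (u - u') < δ T Λ →
            ∃ ψ, P.IsSol x u T ψ ∧ (∀ φ, P.IsSol x u T φ → EqOn φ ψ (Icc 0 T)) ∧
              normC T (ψ - ψ') ≤ C T Λ * (‖x - x'‖ + normL2 T (u - u'))) ∧
          ∀ (x₁ x₂ : X) (u₁ u₂ : ℝ → E), MemL2 T u₁ → MemL2 T u₂ →
            ‖x₁ - x'‖ + normL2 T (u₁ - u') < δ T Λ →
            ‖x₂ - x'‖ + normL2 T (u₂ - u') < δ T Λ →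
            ∀ φ₁ φ₂, P.IsSol x₁ u₁ T φ₁ → P.IsSol x₂ u₂ T φ₂ →
              normC T (φ₁ - φ₂) ≤ C T Λ * (‖x₁ - x₂‖ + normL2 T (u₁ - u₂)) := by
  choose L hL hLip using hP
  have hR : ∀ Λ : ℝ, 0 < |Λ| + 1 := fun Λ => by positivity
  -- The radius `|Λ| + 1` leaves a margin around the reference solution and is positive for every
  -- real `Λ`. The factor `2` is the Lipschitz constant of the retraction.
  let C : ℝ → ℝ → ℝ := fun T Λ =>
    (P.trunc _ (hR Λ)).lipConst T (L (|Λ| + 1) * 2) (|Λ| + 1) (|Λ| + 1)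
  have hC : ∀ T Λ, 0 < C T Λ := fun T Λ => lipConst_pos (hR Λ).le
  -- The first bound keeps the control norm below `|Λ| + 1`, the second keeps the truncated solution
  -- within `1/2` of `ψ'` and so inside the ball.
  let δ : ℝ → ℝ → ℝ := fun T Λ => min (1 / 2) (1 / 2 / C T Λ)
  refine ⟨δ, C, fun T Λ => ⟨lt_min (by norm_num) (div_pos (by norm_num) (hC T Λ)), hC T Λ⟩, ?_⟩
  intro x' u' T ψ' hT hu' hψ' Λ hΛ
  have hlip := trunc_lipschitz (hR Λ) (hL _) (hLip (|Λ| + 1))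
  have hK : 0 ≤ L (|Λ| + 1) * 2 := mul_nonneg (hL _) (by norm_num)
  have hψC : ∀ t ∈ Icc 0 T, ‖ψ' t‖ ≤ normC T ψ' := fun t ht => norm_le_normC hψ'.1 ht
  have hu0 := normL2_nonneg T u'
  have hC0 : 0 ≤ normC T ψ' := (norm_nonneg _).trans (hψC 0 ⟨le_rfl, hT⟩)
  have hΛa := le_abs_self Λ
  have hψ'b : ∀ t ∈ Icc 0 T, ‖ψ' t‖ ≤ |Λ| + 1 := fun t ht => by linarith [hψC t ht]
  have hψ't := (isSol_trunc_iff (hR Λ) hψ'b).2 hψ'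
  have hub : ∀ (x : X) (u : ℝ → E), MemL2 T u → ‖x - x'‖ + normL2 T (u - u') < δ T Λ →
      normL2 T u ≤ |Λ| + 1 := fun x u hu hlt => by
    have h1 := normL2_le_add hu hu'
    have h2 : δ T Λ ≤ 1 / 2 := min_le_left _ _
    linarith [norm_nonneg (x - x')]
  have hex : ∀ (x : X) (u : ℝ → E), MemL2 T u → ‖x - x'‖ + normL2 T (u - u') < δ T Λ →
      ∃ ψ, (∀ t ∈ Icc 0 T, ‖ψ t‖ ≤ |Λ| + 1) ∧ P.IsSol x u T ψ ∧
        (∀ φ, P.IsSol x u T φ → EqOn φ ψ (Icc 0 T)) ∧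
        normC T (ψ - ψ') ≤ C T Λ * (‖x - x'‖ + normL2 T (u - u')) := by
    intro x u hu hlt
    obtain ⟨ψ, hψ⟩ := exists_isSol_of_lipschitz (P := P.trunc _ (hR Λ)) hT hK hlip x hu
    have hdiff : ∀ t ∈ Icc 0 T,
        ‖ψ t - ψ' t‖ ≤ C T Λ * (‖x - x'‖ + normL2 T (u - u')) := fun t ht =>
      hψ.norm_sub_le hψ't hu hu' hK (hR Λ).le hlip (hub x u hu hlt) hψ'b ht
    have hsmall : C T Λ * (‖x - x'‖ + normL2 T (u - u')) ≤ 1 / 2 := by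
      have h1 := hlt.le.trans (min_le_right _ _)
      rwa [le_div_iff₀' (hC T Λ)] at h1
    have hb : ∀ t ∈ Icc 0 T, ‖ψ t‖ ≤ |Λ| + 1 := fun t ht => by
      linarith [norm_le_norm_sub_add (ψ t) (ψ' t), hdiff t ht, hψC t ht]
    have hψP := (isSol_trunc_iff (hR Λ) hb).1 hψ
    exact ⟨ψ, hb, hψP, fun φ hφ => IsSol.eqOn (fun R => ⟨L R, hL R, hLip R⟩) hu hφ hψP,
      normC_le hT hdiff⟩
  refine ⟨fun x u hu hlt => ?_, ?_⟩
  · obtain ⟨ψ, -, h⟩ := hex x u hu hlt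
    exact ⟨ψ, h⟩
  · intro x₁ x₂ u₁ u₂ hu₁ hu₂ hlt₁ hlt₂ φ₁ φ₂ hφ₁ hφ₂
    -- Any solution coincides with the one built by truncation, hence inherits its bound.
    have hb : ∀ (x : X) (u : ℝ → E) (φ : ℝ → X), MemL2 T u →
        ‖x - x'‖ + normL2 T (u - u') < δ T Λ → P.IsSol x u T φ →
          ∀ t ∈ Icc 0 T, ‖φ t‖ ≤ |Λ| + 1 := fun x u φ hu hlt hφ t ht => by
      obtain ⟨ψ, hψb, -, huniq, -⟩ := hex x u hu hlt
      rw [huniq φ hφ ht]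
      exact hψb t ht
    have hb₁ := hb x₁ u₁ φ₁ hu₁ hlt₁ hφ₁
    have hb₂ := hb x₂ u₂ φ₂ hu₂ hlt₂ hφ₂
    exact normC_le hT fun t ht =>
      ((isSol_trunc_iff (hR Λ) hb₁).2 hφ₁).norm_sub_le ((isSol_trunc_iff (hR Λ) hb₂).2 hφ₂)
        hu₁ hu₂ hK (hR Λ).le hlip (hub x₁ u₁ hu₁ hlt₁) hb₂ ht

end SemilinearProblem

/-! ### The Ginzburg–Landau equation as an abstract problem. -/

namespace Sobolev

variable {d : ℕ} {s : ℝ}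

theorem fourierCoef_add_apply (f g : Sobolev d s) (k : Fin d → ℤ) :
    fourierCoef (f + g : Sobolev d s) k = fourierCoef f k + fourierCoef g k := by
  rw [map_add, fourierCoef_add]

theorem fourierCoef_smul_apply (c : ℂ) (f : Sobolev d s) (k : Fin d → ℤ) :
    fourierCoef (c • f : Sobolev d s) k = c * fourierCoef f k := by
  rw [map_smul, fourierCoef_smul]

theorem fourierCoef_sub_apply (f g : Sobolev d s) (k : Fin d → ℤ) :
    fourierCoef (f - g : Sobolev d s) k = fourierCoef f k - fourierCoef g k := by
  rw [eq_sub_iff_add_eq, ← fourierCoef_add_apply, sub_add_cancel]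

end Sobolev

open Sobolev

variable {d : ℕ} {s : ℝ} (V ν : ℝ)

theorem semigroup_add_right (t : ℝ≥0) (f g : Sobolev d s) :
    semigroup V ν t (f + g) = semigroup V ν t f + semigroup V ν t g :=
  ext_fourierCoef fun k => by
    simp only [fourierCoef_semigroup, fourierCoef_add_apply, mul_add]

theorem semigroup_smul_right (t : ℝ≥0) (c : ℂ) (f : Sobolev d s) :
    semigroup V ν t (c • f) = c • semigroup V ν t f :=
  ext_fourierCoef fun k => by
    simp only [fourierCoef_semigroup, fourierCoef_smul_apply, mul_left_comm]

theorem semigroup_zero (f : Sobolev d s) : semigroup V ν 0 f = f :=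
  ext_fourierCoef fun k => by simp [fourierCoef_semigroup, symbol]

theorem semigroup_add (a b : ℝ≥0) (f : Sobolev d s) :
    semigroup V ν (a + b) f = semigroup V ν a (semigroup V ν b f) :=
  ext_fourierCoef fun k => by
    simp only [fourierCoef_semigroup, symbol]
    rw [← mul_assoc, ← Complex.exp_add]
    push_cast
    ring_nf

theorem norm_semigroup_le (t : ℝ≥0) (f : Sobolev d s) :
    ‖semigroup V ν t f‖ ≤ Real.exp (V * t) * ‖f‖ := by
  refine le_of_sq_le_sq ?_ (by positivity)
  rw [mul_pow, norm_sq_eq, norm_sq_eq f, ← tsum_mul_left]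
  refine (semigroup V ν t f).summable.tsum_le_tsum (fun k => ?_) (f.summable.mul_left _)
  have hw := weight_pos s k
  rw [fourierCoef_semigroup, norm_mul, mul_pow, mul_left_comm]
  gcongr
  exact norm_symbol_le V ν t k

/-- The semigroup as a family of bounded operators. -/
noncomputable def semigroupCLM (t : ℝ≥0) : Sobolev d s →L[ℝ] Sobolev d s :=
  LinearMap.mkContinuous
    { toFun := semigroup V ν t
      map_add' := semigroup_add_right V ν t
      map_smul' := fun r => semigroup_smul_right V ν t (r : ℂ) }
    (Real.exp (V * t)) (norm_semigroup_le V ν t)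

/-- Dominated convergence in the series for `‖·‖ₛ²`: each symbol is continuous in `t` and, for `t <
t₀ + 1`, bounded independently of `k`. -/
theorem continuous_semigroup_apply (hV : 0 ≤ V) (f : Sobolev d s) :
    Continuous fun t => semigroup V ν t f := by
  refine continuous_iff_continuousAt.2 fun t₀ => tendsto_iff_norm_sub_tendsto_zero.2 ?_
  have hsq : ∀ t, ‖semigroup V ν t f - semigroup V ν t₀ f‖ ^ 2 =
      ∑' k, weight s k * ‖(symbol V ν t k - symbol V ν t₀ k) * fourierCoef f k‖ ^ 2 :=
    fun t => by
      rw [norm_sq_eq]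
      simp only [fourierCoef_sub_apply, fourierCoef_semigroup, sub_mul]
  have hlim : Tendsto (fun t => ‖semigroup V ν t f - semigroup V ν t₀ f‖ ^ 2) (𝓝 t₀) (𝓝 0) := by
    simp only [hsq]
    rw [show (0 : ℝ) = ∑' _ : Fin d → ℤ, (0 : ℝ) by simp]
    refine tendsto_tsum_of_dominated_convergence
      (f.summable.mul_left ((2 * Real.exp (V * (t₀ + 1))) ^ 2)) (fun k => ?_) ?_
    · have hc : Continuous fun t : ℝ≥0 => weight s k *
          ‖(symbol V ν t k - symbol V ν t₀ k) * fourierCoef f k‖ ^ 2 := by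
        unfold symbol
        fun_prop
      simpa using hc.tendsto t₀
    · filter_upwards [gt_mem_nhds (lt_add_one t₀)] with t ht k
      have hw := weight_pos s k
      have ht' : (t : ℝ) ≤ t₀ + 1 := by exact_mod_cast ht.le
      have h1 : ‖symbol V ν t k - symbol V ν t₀ k‖ ≤ 2 * Real.exp (V * (t₀ + 1)) := by
        have h2 : Real.exp (V * t) ≤ Real.exp (V * (t₀ + 1)) := by gcongr
        have h3 : Real.exp (V * t₀) ≤ Real.exp (V * (t₀ + 1)) := by gcongr; linarith
        linarith [norm_sub_le (symbol V ν t k) (symbol V ν t₀ k), norm_symbol_le V ν t k,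
          norm_symbol_le V ν t₀ k]
      rw [Real.norm_eq_abs, abs_of_nonneg (by positivity), norm_mul, mul_pow, mul_left_comm]
      gcongr
  have := hlim.sqrt
  simpa [Real.sqrt_sq (norm_nonneg _)] using this

/-- Strong continuity together with locally uniform operator bounds. -/
theorem continuous_semigroup (hV : 0 ≤ V) :
    Continuous fun p : ℝ≥0 × Sobolev d s => semigroup V ν p.1 p.2 := by
  refine continuous_iff_continuousAt.2 fun p₀ => tendsto_iff_norm_sub_tendsto_zero.2 ?_
  have hlim : Tendsto (fun p : ℝ≥0 × Sobolev d s => Real.exp (V * p.1) * ‖p.2 - p₀.2‖ +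
      ‖semigroup V ν p.1 p₀.2 - semigroup V ν p₀.1 p₀.2‖) (𝓝 p₀) (𝓝 0) := by
    have hc : Continuous fun p : ℝ≥0 × Sobolev d s => Real.exp (V * p.1) * ‖p.2 - p₀.2‖ +
        ‖semigroup V ν p.1 p₀.2 - semigroup V ν p₀.1 p₀.2‖ := by
      have := (continuous_semigroup_apply V ν hV p₀.2).comp (continuous_fst (Y := Sobolev d s))
      simp only [Function.comp_def] at this
      fun_prop
    simpa using hc.tendsto p₀
  refine squeeze_zero (fun _ => norm_nonneg _) (fun p => ?_) hlim
  have e : semigroup V ν p.1 p.2 - semigroup V ν p₀.1 p₀.2 =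
      semigroup V ν p.1 (p.2 - p₀.2) +
        (semigroup V ν p.1 p₀.2 - semigroup V ν p₀.1 p₀.2) := by
    have h := semigroup_add_right V ν p.1 (p.2 - p₀.2) p₀.2
    rw [sub_add_cancel] at h
    rw [h]
    abel
  rw [e]
  exact (norm_add_le _ _).trans (add_le_add (norm_semigroup_le V ν _ _) le_rfl)

/-- The Ginzburg–Landau equation as an abstract semilinear problem on `Hˢ`. -/
theorem exists_semilinearProblem {q : ℕ} (σ : ℕ) (μ r₁ r₂ : ℝ) (hV : 0 ≤ V)
    {Q : Torus d → EuclideanSpace ℝ (Fin q)} (hQ : SmoothField Q) (hs : (d : ℝ) / 2 < s) :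
    ∃ P : SemilinearProblem (Sobolev d s) (EuclideanSpace ℝ (Fin q)), P.LocLip ∧
      ∀ (x : Sobolev d s) (u : ℝ → EuclideanSpace ℝ (Fin q)) (T : ℝ) (φ : ℝ → Sobolev d s),
        MemL2 T u → (IsMildSolution V ν μ r₁ r₂ σ Q x u T φ ↔ P.IsSol x u T φ) := by
  obtain ⟨N, hN, hLip⟩ := actsOn_power (d := d) hs (-(1 + Complex.I * μ)) σ
  obtain ⟨B, hB⟩ := exists_control_operator hs hQ (r₁ + Complex.I * r₂)
  have hcont : Continuous N := continuous_iff_continuousAt.2 fun f => by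
    obtain ⟨L, hL, h⟩ := hLip (‖f‖ + 1)
    refine tendsto_iff_norm_sub_tendsto_zero.2 (squeeze_zero' (g := fun g => L * ‖g - f‖)
      (Eventually.of_forall fun _ => norm_nonneg _) ?_ ?_)
    · filter_upwards [Metric.ball_mem_nhds f one_pos] with g hg
      rw [Metric.mem_ball, dist_eq_norm] at hg
      exact (h g f (by linarith [norm_le_norm_sub_add g f]) (by linarith)).2
    · have : Continuous fun g => L * ‖g - f‖ := by fun_prop
      simpa using this.tendsto f
  let P : SemilinearProblem (Sobolev d s) (EuclideanSpace ℝ (Fin q)) :=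
    { S := semigroupCLM V ν
      growth := V
      growth_nonneg := hV
      S_zero := semigroup_zero V ν
      S_add := semigroup_add V ν
      norm_S_le := norm_semigroup_le V ν
      continuous_S := continuous_semigroup V ν hV
      N := N
      continuous_N := hcont
      B := B }
  have hforce : ∀ (u : ℝ → EuclideanSpace ℝ (Fin q)) (φ : ℝ → Sobolev d s) (τ : ℝ),
      P.forcing u φ τ =ᵐ[torusMeasure d] nonlinearity μ r₁ r₂ σ Q (u τ) (φ τ) := fun u φ τ => by
    filter_upwards [coeFn_add (N (φ τ)) (B (u τ) (φ τ)), hN (φ τ), hB (u τ) (φ τ)]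
      with x h1 h2 h3
    change (N (φ τ) + B (u τ) (φ τ) : Sobolev d s) x = _
    rw [h1, h2, h3, nonlinearity]
  refine ⟨P, fun R => ?_, fun x u T φ hu => ⟨?_, fun h => ?_⟩⟩
  · obtain ⟨L, hL, h⟩ := hLip R
    exact ⟨L, hL, fun f g hf hg => (h f g hf hg).2⟩
  · rintro ⟨hφ, F, hF, h⟩
    refine ⟨hφ, fun t ht => (h t ht).2.trans ?_⟩
    refine congrArg _ (SemilinearProblem.duhamel_congr (P := P) ht.1 fun τ hτ => ?_)
    -- The forcing `F` in a mild solution is prescribed a.e. on the torus, so as an element of `Hˢ`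
    -- it must be `P.forcing u φ`.
    exact ext_ae ((hF τ ⟨hτ.1, hτ.2.trans ht.2⟩).trans (hforce u φ τ).symm)
  · exact ⟨h.1, P.forcing u φ, fun τ _ => hforce u φ τ, fun t ht =>
      ⟨SemilinearProblem.intervalIntegrable_S_sub (P := P)
        (SemilinearProblem.integrableOn_forcing (P := P) hu h.1) le_rfl ht.1 ht.2, h.2 t ht⟩⟩

end CGL

/-! ### The theorem for the Ginzburg–Landau equation. -/

theorem mainTheorem6 (d q σ : ℕ) (hd : 1 ≤ d) (hq : 1 ≤ q) (hσ : 1 ≤ σ)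
    (V ν μ r₁ r₂ : ℝ) (hV : 0 ≤ V)
    (Q : CGL.Torus d → EuclideanSpace ℝ (Fin q)) (hQ : CGL.SmoothField Q)
    (s : ℝ) (hs : (d : ℝ) / 2 < s) :
    ∃ δ C : ℝ → ℝ → ℝ, (∀ T Λ, 0 < δ T Λ ∧ 0 < C T Λ) ∧
      ∀ (ψ₀' : CGL.Sobolev d s) (u' : ℝ → EuclideanSpace ℝ (Fin q)),
        (∀ T, CGL.MemL2 T u') →
        ∃ (Tmax : EReal) (ψ' : ℝ → CGL.Sobolev d s), 0 < Tmax ∧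
          -- existence and uniqueness on every compact interval inside the existence time
          (∀ T : ℝ, 0 ≤ T → (T : EReal) < Tmax →
            CGL.IsMildSolution V ν μ r₁ r₂ σ Q ψ₀' u' T ψ' ∧
            ∀ φ : ℝ → CGL.Sobolev d s, CGL.IsMildSolution V ν μ r₁ r₂ σ Q ψ₀' u' T φ →
              Set.EqOn φ ψ' (Set.Icc 0 T)) ∧
          -- maximality of the existence time
          (∀ T : ℝ, Tmax ≤ (T : EReal) →
            ¬ ∃ φ : ℝ → CGL.Sobolev d s, CGL.IsMildSolution V ν μ r₁ r₂ σ Q ψ₀' u' T φ) ∧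
          -- blow-up
          (Tmax < ⊤ → Tendsto (fun t => ‖ψ' t‖) (𝓝[<] Tmax.toReal) atTop) ∧
          -- stability and Lipschitz continuity of the solution map
          ∀ T : ℝ, 0 ≤ T → (T : EReal) < Tmax →
            ∀ Λ : ℝ, Λ = CGL.normC T ψ' + CGL.normL2 T u' →
              (∀ (ψ₀ : CGL.Sobolev d s) (u : ℝ → EuclideanSpace ℝ (Fin q)), CGL.MemL2 T u →
                ‖ψ₀ - ψ₀'‖ + CGL.normL2 T (u - u') < δ T Λ →
                ∃ ψ : ℝ → CGL.Sobolev d s,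
                  CGL.IsMildSolution V ν μ r₁ r₂ σ Q ψ₀ u T ψ ∧
                  (∀ φ : ℝ → CGL.Sobolev d s, CGL.IsMildSolution V ν μ r₁ r₂ σ Q ψ₀ u T φ →
                    Set.EqOn φ ψ (Set.Icc 0 T)) ∧
                  CGL.normC T (ψ - ψ') ≤
                    C T Λ * (‖ψ₀ - ψ₀'‖ + CGL.normL2 T (u - u'))) ∧
              ∀ (ψ₀₁ ψ₀₂ : CGL.Sobolev d s) (u₁ u₂ : ℝ → EuclideanSpace ℝ (Fin q)),
                CGL.MemL2 T u₁ → CGL.MemL2 T u₂ →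
                ‖ψ₀₁ - ψ₀'‖ + CGL.normL2 T (u₁ - u') < δ T Λ →
                ‖ψ₀₂ - ψ₀'‖ + CGL.normL2 T (u₂ - u') < δ T Λ →
                ∀ φ₁ φ₂ : ℝ → CGL.Sobolev d s,
                  CGL.IsMildSolution V ν μ r₁ r₂ σ Q ψ₀₁ u₁ T φ₁ →
                  CGL.IsMildSolution V ν μ r₁ r₂ σ Q ψ₀₂ u₂ T φ₂ →
                  CGL.normC T (φ₁ - φ₂) ≤
                    C T Λ * (‖ψ₀₁ - ψ₀₂‖ + CGL.normL2 T (u₁ - u₂)) := by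
  have := CGL.Sobolev.completeSpace (d := d) (s := s) (le_trans (by positivity) hs.le)
  obtain ⟨P, hP, hsol⟩ := CGL.exists_semilinearProblem V ν σ μ r₁ r₂ hV hQ hs
  obtain ⟨δ, C, hpos, hstab⟩ := CGL.SemilinearProblem.exists_stability hP
  refine ⟨δ, C, hpos, fun ψ₀' u' hu' => ?_⟩
  obtain ⟨Tmax, ψ', hT, hex, hno, hblow⟩ := CGL.SemilinearProblem.exists_maximal hP ψ₀' hu'
  refine ⟨Tmax, ψ', hT, fun T hT0 hTm => ⟨(hsol _ _ _ _ (hu' T)).2 (hex T hT0 hTm), fun φ hφ => ?_⟩,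
    fun T hTm ⟨φ, hφ⟩ => hno T hTm ⟨φ, (hsol _ _ _ _ (hu' T)).1 hφ⟩, hblow,
    fun T hT0 hTm Λ hΛ => ?_⟩
  · exact CGL.SemilinearProblem.IsSol.eqOn hP (hu' T) ((hsol _ _ _ _ (hu' T)).1 hφ)
      (hex T hT0 hTm)
  obtain ⟨h1, h2⟩ := hstab ψ₀' u' T ψ' hT0 (hu' T) (hex T hT0 hTm) Λ hΛ
  refine ⟨fun ψ₀ u hu hlt => ?_, fun x₁ x₂ u₁ u₂ hu₁ hu₂ hlt₁ hlt₂ φ₁ φ₂ hφ₁ hφ₂ => ?_⟩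
  · obtain ⟨ψ, hψ, huniq, hle⟩ := h1 ψ₀ u hu hlt
    exact ⟨ψ, (hsol _ _ _ _ hu).2 hψ, fun φ hφ => huniq φ ((hsol _ _ _ _ hu).1 hφ), hle⟩
  · exact h2 x₁ x₂ u₁ u₂ hu₁ hu₂ hlt₁ hlt₂ φ₁ φ₂ ((hsol _ _ _ _ hu₁).1 hφ₁)
      ((hsol _ _ _ _ hu₂).1 hφ₂)
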